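/- Let $p$ be a prime and let $\mathbb F_p=\{0,1,\dots,p-1\}$. Let $\mathbb F_p^{\mathbb N}$ be the space of sequences $x=(x_i)_{i\ge 0}$ over $\mathbb F_p$ with only finitely many nonzero entries, with Hamming distance $d(x,y)=\#\{i : x_i\ne y_i\}$ and standard basis $E=(e_i)_{i\ge0}$. For $\xi\ne\eta$ in $\mathbb N$ let $F(\xi,\eta)$ be the basis obtained from $E$ by replacing $e_\xi$ by $e_\xi+e_\eta$, and let $\mathcal F=\{E\}\cup\{F(\xi,\eta):\xi\neq\eta\}$. An ordered basis $F=(f_i)_{i\ge 0}$ induces a total order $<_F$: writing $x=\sum_i x_i^F f_i$ and $y=\sum_i y_i^F f_i$ for $x\ne y$, put $x<_F y$ if $x^F_N<y^F_N$ for the largest $N$ with $x^F_N\neq y^F_N$. For $d\ge 2$ define $w^-(a)$, $a\in\mathbb N$, recursively: if $a$ is a power of $p$ (including $1=p^0$), then $w^-(a)$ is the $<_F$-minimum of all $z$ with $d(z,w^-(b))\ge d$ for $0\le b<a$; otherwise $w^-(a)=\sum_i a_i\,w^-(p^i)$, where $a=\sum_i a_ip^i$ is the base-$p$ expansion. Let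 $\mathrm{Lex}^-_{F,d}(m)=\{w^-(0),\dots,w^-(p^m-1)\}$, and let $\mathrm{Res}(L)$ be obtained from a finite set $L$ of sequences by deleting all coordinates at which every member of $L$ vanishes. A linear code of dimension $K$ over $\mathbb F_p$ is called a Solomon–Stiffler code if it has a generator matrix without zero columns for which there are an integer $s\ge0$ and finitely many nonzero proper subspaces $U_1,\dots,U_h$ of $\mathbb F_p^K$, at most $p-1$ of each dimension, such that every one-dimensional subspace $P$ of $\mathbb F_p^K$ lies in at most $s$ of the $U_i$ and contains exactly $s-\#\{i:P\subseteq U_i\}$ columns of the matrix, counted with multiplicity. **Theorem.** Let $k\ge 1$, $q\ge0$, $0<r<p$ be integers with $q+r-p+1\ge 2$, let $d=p^{k-1}(pq+r)$, and let $F\in\mathcal F$. Then $\mathrm{Res}(\mathrm{Lex}^-_{F,d}(k+1))$ is a linear code of length $\frac{p^k-1}{p-1}(pq+r)+q+1$, dimension $k+1$ and minimum distance exactly $d$, and it is a Solomon–Stiffler code. Moreover, the matrix with rows $w^-(p^0),w^-(p^1),\dots,w^-(p^k)$ is $\pi_d$-distributed: a nonzero vector $v=(v_0,\dots,v_k)\in\mathbb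 F_p^{k+1}$ occurs exactly $\pi_d(v)$ times among its columns, where $$\pi_d(v)=\begin{cases}0 & \text{if the first nonzero entry of } v \text{ is not } 1,\\ \lceil d/p^k\rceil=q+1 & \text{if the first nonzero entry of } v \text{ is } 1 \text{ and } v_0+\dots+v_k\ne0,\\ q+r-p+1 & \text{if the first nonzero entry of } v \text{ is } 1 \text{ and } v_0+\dots+v_k=0.\end{cases}$$ -/

import Mathlib

noncomputable section

namespace LexCode

variable {p : ℕ}

/-- Finitely supported sequences over `𝔽_p`, indexed by the natural numbers. -/
abbrev Vec (p : ℕ) : Type := ℕ →₀ ZMod p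

/-- The strict order on sequences induced by an ordered basis `F`: at the largest index at which
the `F`-coordinates differ, compare them as elements of `{0, …, p - 1}`. -/
def basisLT (F : Module.Basis ℕ (ZMod p) (Vec p)) (x y : Vec p) : Prop :=
  ∃ N : ℕ, (F.repr x N).val < (F.repr y N).val ∧ ∀ i, N < i → F.repr x i = F.repr y i

theorem basisLT_wf (F : Module.Basis ℕ (ZMod p) (Vec p)) : WellFounded (basisLT F) := by
  have h := Finsupp.Lex.wellFounded' (r := fun i j : ℕ => j < i)
    (s := fun a b : ZMod p => a.val < b.val)
    (fun n hn => by simp at hn)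
    (InvImage.wf ZMod.val Nat.lt_wfRel.wf) (Nat.lt_wfRel.wf)
  refine Subrelation.wf ?_ (InvImage.wf (fun x => F.repr x) h)
  rintro x y ⟨N, h1, h2⟩
  exact ⟨N, fun j hj => h2 j hj, h1⟩

open Classical in
/-- The minimum of a nonempty set of sequences for the order induced by `F`. -/
def basisMin (F : Module.Basis ℕ (ZMod p) (Vec p)) (S : Set (Vec p)) : Vec p :=
  if h : S.Nonempty then (basisLT_wf F).min S h else 0

/-- Hamming distance of two finitely supported sequences. -/
def dist (x y : Vec p) : ℕ := (x.neLocus y).card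

open Classical in
/-- The words `w⁻(a)`: if `a` is a power of `p`, the least sequence at Hamming distance at
least `d` from all `w⁻(b)` with `b < a`; otherwise `∑ i, aᵢ w⁻(p ^ i)`, where `aᵢ` is the `i`-th
digit of `a` in base `p`.  (For a prime `p`, the indices of the nonzero digits of such an `a`
satisfy `i < a` and `p ^ i < a`.) -/
def word (F : Module.Basis ℕ (ZMod p) (Vec p)) (d : ℕ) (a : ℕ) : Vec p :=
  if ∃ j, a = p ^ j then
    basisMin F {z | ∀ b, (_h : b < a) → d ≤ dist z (word F d b)}
  else
    ∑ i ∈ Finset.range a,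
      if _h : p ^ i < a then ((a / p ^ i % p : ℕ) : ZMod p) • word F d (p ^ i) else 0
termination_by a

/-- The code `Lex⁻_{F,d}(m) = {w⁻(0), …, w⁻(p ^ m - 1)}`. -/
def lexCode (F : Module.Basis ℕ (ZMod p) (Vec p)) (d m : ℕ) : Finset (Vec p) :=
  (Finset.range (p ^ m)).image (word F d)

/-- The union of the (standard) supports of the members of a finite set of sequences. -/
def codeSupp (L : Finset (Vec p)) : Finset ℕ :=
  L.biUnion Finsupp.support

/-- `Res(L)`: delete the coordinates at which all members of `L` vanish. -/
def res (L : Finset (Vec p)) : Set (codeSupp L → ZMod p) :=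
  (fun x i => x i) '' (L : Set (Vec p))

/-- The standard basis `e₀, e₁, …`. -/
def stdBasis (p : ℕ) : Module.Basis ℕ (ZMod p) (Vec p) :=
  Finsupp.basisSingleOne

/-- The basis that differs from the standard one only at the index `ξ`, where it has
`e_ξ + e_η`. -/
def twistBasis (p : ℕ) (ξ η : ℕ) (h : ξ ≠ η) : Module.Basis ℕ (ZMod p) (Vec p) :=
  (stdBasis p).map
    (LinearEquiv.transvection (f := Finsupp.lapply ξ) (v := Finsupp.single η (1 : ZMod p))
      (by simp [h.symm]))

theorem twistBasis_apply (p ξ η : ℕ) (h : ξ ≠ η) (i : ℕ) :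
    twistBasis p ξ η h i =
      if i = ξ then Finsupp.single ξ 1 + Finsupp.single η 1 else Finsupp.single i 1 := by
  unfold twistBasis stdBasis
  rw [Module.Basis.map_apply, Finsupp.coe_basisSingleOne, LinearEquiv.transvection.apply]
  by_cases hi : i = ξ
  · subst hi; simp
  · simp [hi]

/-- The family consisting of the standard basis and all the bases `twistBasis p ξ η`. -/
def basisFamily (p : ℕ) : Set (Module.Basis ℕ (ZMod p) (Vec p)) :=
  {stdBasis p} ∪ {F | ∃ (ξ η : ℕ) (h : ξ ≠ η), F = twistBasis p ξ η h}

/-- `C` is an `[n, k, d]` code: its dimension is `k`, its length is `n`, and its minimum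
distance is exactly `d`. -/
def HasParams {ι : Type} [Fintype ι] (C : Submodule (ZMod p) (ι → ZMod p)) (n k d : ℕ) : Prop :=
  Fintype.card ι = n ∧ Module.finrank (ZMod p) C = k ∧
    IsLeast {e | ∃ x ∈ C, ∃ y ∈ C, x ≠ y ∧ e = hammingDist x y} d

/-- `C` is a Solomon–Stiffler code of dimension `K`: it has a generator matrix without zero columns
whose columns, regarded as points of the projective space of lines in `𝔽_p ^ K`, are obtained from
`s` copies of the whole space by deleting the points of subspaces `U 0, …, U (h - 1)`, which are
nonzero and proper, of which at most `p - 1` have any given dimension, and no `s + 1` of which share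
a point.  The last line says that each line `P` is left with `s - #{i | P ≤ U i}` columns, and that
this number is not negative. -/
def IsSolomonStiffler {ι : Type} [Fintype ι] (C : Submodule (ZMod p) (ι → ZMod p)) (K : ℕ) :
    Prop :=
  ∃ (G : Matrix (Fin K) ι (ZMod p)) (s h : ℕ) (U : Fin h → Submodule (ZMod p) (Fin K → ZMod p)),
    LinearIndependent (ZMod p) G.row ∧
    Submodule.span (ZMod p) (Set.range G.row) = C ∧
    (∀ j, G.col j ≠ 0) ∧
    (∀ i, 0 < Module.finrank (ZMod p) (U i) ∧ Module.finrank (ZMod p) (U i) < K) ∧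
    (∀ u : ℕ, Nat.card {i // Module.finrank (ZMod p) (U i) = u} ≤ p - 1) ∧
    ∀ P : Submodule (ZMod p) (Fin K → ZMod p), Module.finrank (ZMod p) P = 1 →
      Nat.card {j // G.col j ∈ P} + Nat.card {i // P ≤ U i} = s

/-- The matrix with rows `w⁻(p ^ 0), …, w⁻(p ^ l)`, with columns indexed by the natural numbers. -/
def genMatrix (F : Module.Basis ℕ (ZMod p) (Vec p)) (d l : ℕ) : Matrix (Fin (l + 1)) ℕ (ZMod p) :=
  Matrix.of fun j i => word F d (p ^ (j : ℕ)) i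

/-- Columns whose first nonzero entry exists and equals `1`. -/
def normalized (p l : ℕ) : Set (Fin (l + 1) → ZMod p) :=
  {v | ∃ i, v i = 1 ∧ ∀ j, j < i → v j = 0}

open Classical in
/-- The prescribed multiplicity `π_d(v)` of a nonzero column `v` of height `l + 1 ≤ k + 1`, where
`d = p ^ (k - 1) * (p * q + r)` and `p ≤ q + r + 1`. -/
def piMult (p k q r d l : ℕ) (v : Fin (l + 1) → ZMod p) : ℕ :=
  if v ∈ normalized p l then
    if l < k ∨ ∑ i, v i ≠ 0 then ⌈(d : ℚ) / (p : ℚ) ^ l⌉₊ else q + r + 1 - p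
  else 0

/-- A matrix with finitely many nonzero columns is `π_d`-distributed if each nonzero column vector
`v` occurs exactly `π_d(v)` times as a column. -/
def IsPiDistributed (k q r d : ℕ) {l : ℕ} (G : Matrix (Fin (l + 1)) ℕ (ZMod p)) : Prop :=
  ∀ v : Fin (l + 1) → ZMod p, v ≠ 0 →
    {i : ℕ | G.col i = v}.encard = (piMult p k q r d l v : ℕ∞)

end LexCode

end

/-! Suppose that on the support `S` of the words found so far every normalized column (first nonzero
entry 1) occurs `D` times, with `p * d = p ^ l * D`, and write `D + m = p * t` with `m < p`. The
next word `z` is studied block by block, a block being the set of positions with a given column.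
Averaging the agreements of `z` with all codewords shows that `z` needs at least `t` nonzero entries
outside `S`. If it has exactly `t`, averaging over the codewords with one prescribed value at a
column shows that no value occurs more than `t` times on a block (`Avoids.cnt_le`). Averaging over
the codewords that avoid one value at each of two columns shows that scarcity of a value propagates
along projective lines (`Avoids.cnt_line_le`).

The order makes large residues expensive, so on the block of a unit vector the value `-1` is the
scarce one, occurring `t - m` times. Propagation then forces the value `-∑ v i` to be scarce on the
block of `v`. Conversely, every word with these multiplicities `nst`, and with `t` nonzero entries
outside `S`, is far enough from the code (`Balanced.avoids_of_distributed`). The appended columns of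
coordinate sum zero thus occur `t - m` times and all other normalized columns `t` times.

That the greedy word really has this form is an exchange argument. If an admissible word preceded
the least word of this form, its part from the decisive position upward could be completed to a word
of this form, a contradiction. This works because the blocks of the unit vectors in the support of
`v` lie above the block of `v` (`Layered`), so they have been decided already. For a twisted basis
only the comparison at `η` changes, to `x η - x ξ`. If `η < ξ` this is a shift by an entry already
fixed. If `ξ < η` both positions enter the support together, with equal columns, and they receive
equal entries from then on. At most two positions violate the layering, which is harmless since `t -
m ≥ 2`.

For the first `k` words `m = 0`, so the columns stay balanced. The last word has `D = p * q + r`, `t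
= q + 1`, `m = p - r`, which gives the multiplicities of the theorem; the missing columns are `p -
r` copies of the hyperplane of coordinate sum zero. -/

noncomputable section

namespace LexCode

open Finset
open scoped Classical Matrix

/-! ### Normalized vectors and counting solutions of linear conditions -/

section Counting

variable {p : ℕ} [Fact p.Prime] {l : ℕ}

/-- The first nonzero entry exists and equals `1`. -/
def IsNormalized (v : Fin l → ZMod p) : Prop := ∃ i, v i = 1 ∧ ∀ j, j < i → v j = 0

theorem IsNormalized.ne_zero {v : Fin l → ZMod p} (h : IsNormalized v) : v ≠ 0 := by
  rintro rfl
  obtain ⟨i, hi, -⟩ := h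
  simp at hi

theorem IsNormalized.eq_of_smul {u v : Fin l → ZMod p} (hu : IsNormalized u)
    (hv : IsNormalized v) {a : ZMod p} (h : u = a • v) : u = v := by
  have ha : a ≠ 0 := by
    rintro rfl
    exact hu.ne_zero (by simpa using h)
  obtain ⟨i, hi, hi'⟩ := hu
  obtain ⟨j, hj, hj'⟩ := hv
  have hij : i = j := by
    rcases lt_trichotomy i j with hlt | heq | hlt
    · have := congrFun h i
      simp [hi, hj' i hlt] at this
    · exact heq
    · have := congrFun h j
      simp [hj, hi' j hlt] at this
      exact absurd this.symm ha
  subst hij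
  have := congrFun h i
  simp [hi, hj] at this
  rw [h, ← this, one_smul]

theorem exists_isNormalized_smul {v : Fin l → ZMod p} (h : v ≠ 0) :
    ∃ a : ZMod p, a ≠ 0 ∧ ∃ u, IsNormalized u ∧ v = a • u := by
  have hne : (univ.filter fun i => v i ≠ 0).Nonempty := by
    by_contra hc
    rw [not_nonempty_iff_eq_empty, filter_eq_empty_iff] at hc
    exact h (funext fun i => by simpa using hc (mem_univ i))
  set i := (univ.filter fun i => v i ≠ 0).min' hne with hi
  have hvi : v i ≠ 0 := (mem_filter.1 (min'_mem _ hne)).2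
  refine ⟨v i, hvi, (v i)⁻¹ • v, ⟨i, by simp [hvi], fun j hj => ?_⟩, by simp [smul_smul, hvi]⟩
  by_contra hc
  have hvj : v j ≠ 0 := by
    intro h0
    simp [h0] at hc
  exact absurd (min'_le _ j (by simp [hvj])) (not_le.2 hj)

theorem isNormalized_single (j : Fin l) : IsNormalized (Pi.single j (1 : ZMod p)) :=
  ⟨j, by simp, fun i hi => by simp [hi.ne]⟩

/-- Every nonzero vector is uniquely a nonzero scalar times a normalized one, so normalized vectors
represent the points of projective space. -/
theorem card_ne_zero_eq (Q : (Fin l → ZMod p) → Prop)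
    (hQ : ∀ a : ZMod p, a ≠ 0 → ∀ v, Q (a • v) ↔ Q v) :
    #{v : Fin l → ZMod p | v ≠ 0 ∧ Q v} = (p - 1) * #{v : Fin l → ZMod p | IsNormalized v ∧ Q v} := by
  have h1 : #(univ.erase (0 : ZMod p)) = p - 1 := by
    rw [card_erase_of_mem (mem_univ _), card_univ, ZMod.card]
  rw [← h1, ← card_product]
  symm
  refine card_nbij (fun x => x.1 • x.2) ?_ ?_ ?_
  · rintro ⟨a, v⟩ h
    simp only [mem_coe, mem_product, mem_erase, mem_univ, and_true, mem_filter, true_and] at h ⊢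
    exact ⟨smul_ne_zero h.1 h.2.1.ne_zero, (hQ a h.1 v).2 h.2.2⟩
  · rintro ⟨a, v⟩ h ⟨b, w⟩ h' heq
    simp only [mem_coe, mem_product, mem_erase, mem_univ, and_true, mem_filter, true_and] at h h' heq
    have hvw : v = w := h.2.1.eq_of_smul h'.2.1 (a := a⁻¹ * b) (by
      rw [mul_smul, ← heq, smul_smul, inv_mul_cancel₀ h.1, one_smul])
    subst hvw
    obtain ⟨i, hi, -⟩ := h.2.1
    have := congrFun heq i
    simp [hi] at this
    rw [this]
  · intro v h
    simp only [mem_coe, mem_filter, mem_univ, true_and] at h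
    obtain ⟨a, ha, u, hu, rfl⟩ := exists_isNormalized_smul h.1
    exact ⟨(a, u), by simpa [ha, hu] using (hQ a ha u).1 h.2, rfl⟩

/-- The map sending `c` to its products with independent vectors is surjective, so all its fibres
have the same size. Multiplying by the power of `p` avoids a negative exponent. -/
theorem card_dotProduct_mem {ι : Type} [Fintype ι] (u : ι → Fin l → ZMod p)
    (hu : LinearIndependent (ZMod p) u) (s : ι → Finset (ZMod p)) :
    #{c : Fin l → ZMod p | ∀ i, c ⬝ᵥ u i ∈ s i} * p ^ Fintype.card ι = p ^ l * ∏ i, #(s i) := by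
  set f := (Matrix.of u).mulVecLin with hf
  have hfc : ∀ c i, f c i = c ⬝ᵥ u i := fun c i => by
    simp [hf, Matrix.mulVec, dotProduct_comm]
  have hrank : (Matrix.of u).rank = Fintype.card ι :=
    LinearIndependent.rank_matrix (M := Matrix.of u) hu
  have hsurj : Function.Surjective f := by
    rw [← LinearMap.range_eq_top]
    apply Submodule.eq_top_of_finrank_eq
    rw [Module.finrank_fintype_fun_eq_card, ← hrank]
    rfl
  have hfib : ∀ x y : ι → ZMod p, #{c | f c = x} = #{c | f c = y} := fun x y =>
    AddMonoidHom.card_fiber_eq_of_mem_range f.toAddMonoidHom (hsurj x) (hsurj y)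
  have hsum : ∀ T : Finset (ι → ZMod p), #{c | f c ∈ T} = #T * #{c | f c = 0} := by
    intro T
    rw [card_eq_sum_card_fiberwise (f := f) (t := T) (by intro c hc; simpa using hc)]
    rw [← smul_eq_mul, ← sum_const]
    refine sum_congr rfl fun y hy => ?_
    rw [hfib 0 y, filter_filter]
    congr 1
    ext c
    simp only [mem_filter, mem_univ, true_and]
    exact ⟨fun h => h.2, fun h => ⟨h ▸ hy, h⟩⟩
  have hall := hsum univ
  simp only [mem_univ, filter_true, card_univ, Fintype.card_fun, ZMod.card, Fintype.card_fin] at hall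
  have h2 := hsum (Fintype.piFinset s)
  rw [Fintype.card_piFinset] at h2
  have h3 : #{c : Fin l → ZMod p | ∀ i, c ⬝ᵥ u i ∈ s i} = #{c | f c ∈ Fintype.piFinset s} := by
    congr 1
    ext c
    simp [Fintype.mem_piFinset, hfc]
  rw [h3, h2, hall]
  ring

theorem card_dotProduct_one {u : Fin l → ZMod p} (hu : u ≠ 0) (s : Finset (ZMod p)) :
    #{c : Fin l → ZMod p | c ⬝ᵥ u ∈ s} * p = p ^ l * #s := by
  have := card_dotProduct_mem (ι := Fin 1) (fun _ => u)
    (by simpa [linearIndependent_unique_iff] using hu) (fun _ => s)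
  simpa using this

theorem card_dotProduct_two {u v : Fin l → ZMod p} (h : LinearIndependent (ZMod p) ![u, v])
    (s s' : Finset (ZMod p)) :
    #{c : Fin l → ZMod p | c ⬝ᵥ u ∈ s ∧ c ⬝ᵥ v ∈ s'} * p ^ 2 = p ^ l * (#s * #s') := by
  have := card_dotProduct_mem _ h ![s, s']
  simpa [Fin.forall_fin_two] using this

theorem card_dotProduct_three {u v w : Fin l → ZMod p}
    (h : LinearIndependent (ZMod p) ![u, v, w]) (s s' s'' : Finset (ZMod p)) :
    #{c : Fin l → ZMod p | c ⬝ᵥ u ∈ s ∧ c ⬝ᵥ v ∈ s' ∧ c ⬝ᵥ w ∈ s''} * p ^ 3 =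
      p ^ l * (#s * #s' * #s'') := by
  have := card_dotProduct_mem _ h ![s, s', s'']
  simpa [Fin.forall_fin_succ, Fin.prod_univ_three] using this

theorem linearIndependent_pair_of_isNormalized {u v : Fin l → ZMod p} (hu : IsNormalized u)
    (hv : IsNormalized v) (h : u ≠ v) : LinearIndependent (ZMod p) ![u, v] := by
  rw [LinearIndependent.pair_iff' hu.ne_zero]
  intro a ha
  exact h (hv.eq_of_smul hu ha.symm).symm

/-- By `hline` the normalized points of the line through `u` and `v` are `v` and the `u + s • v`; a
normalized `w` different from all of these is off the line. -/
theorem linearIndependent_triple_of_isNormalized {u v w : Fin l → ZMod p} (hu : IsNormalized u)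
    (hv : IsNormalized v) (hw : IsNormalized w) (h : u ≠ v) (hline : ∀ s : ZMod p, IsNormalized (u + s • v))
    (hwv : w ≠ v) (hwu : ∀ s : ZMod p, w ≠ u + s • v) :
    LinearIndependent (ZMod p) ![u, v, w] := by
  have h2 := linearIndependent_pair_of_isNormalized hu hv h
  have h3 : LinearIndependent (ZMod p) (Fin.snoc ![u, v] w : Fin 3 → Fin l → ZMod p) := by
    refine LinearIndependent.finSnoc h2 ?_
    intro hmem
    simp only [Matrix.range_cons, Matrix.range_empty, Set.union_empty, Set.singleton_union,
      Submodule.mem_span_pair] at hmem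
    obtain ⟨a, b, hab⟩ := hmem
    by_cases ha : a = 0
    · subst ha
      exact hwv (hw.eq_of_smul hv (a := b) (by simpa using hab.symm))
    · refine hwu (b / a) (hw.eq_of_smul (hline _) (a := a) ?_)
      rw [← hab, smul_add, smul_smul, mul_div_cancel₀ _ ha]
  convert h3 using 1
  ext i j
  fin_cases i <;> rfl

end Counting

/-! ### Averaging agreements over families of codewords -/

section Averaging

variable {p : ℕ} [Fact p.Prime] {l : ℕ}

/-- The columns with index in `S` are normalized, and each normalized column occurs `D` times. -/
structure Balanced (S : Finset ℕ) (col : ℕ → Fin l → ZMod p) (D : ℕ) : Prop where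
  norm : ∀ i ∈ S, IsNormalized (col i)
  card : ∀ v, IsNormalized v → #{i ∈ S | col i = v} = D

/-- The number of indices in `S` with column `v` at which `z` takes the value `a`. -/
def cnt (S : Finset ℕ) (col : ℕ → Fin l → ZMod p) (z : ℕ → ZMod p) (v : Fin l → ZMod p)
    (a : ZMod p) : ℕ :=
  #{i ∈ S | col i = v ∧ z i = a}

/-- A sequence which extends `z` by `t` nonzero entries outside `S` has distance at least `d` from
all linear combinations of the rows of the matrix with columns `col`. -/
def Avoids (S : Finset ℕ) (col : ℕ → Fin l → ZMod p) (d t : ℕ) (z : ℕ → ZMod p) : Prop :=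
  ∀ c : Fin l → ZMod p, d + #{i ∈ S | c ⬝ᵥ col i = z i} ≤ #S + t

variable {S : Finset ℕ} {col : ℕ → Fin l → ZMod p} {D d t m : ℕ} {z : ℕ → ZMod p}

theorem sum_cnt (S : Finset ℕ) (col : ℕ → Fin l → ZMod p) (z : ℕ → ZMod p) (v : Fin l → ZMod p) :
    ∑ a, cnt S col z v a = #{i ∈ S | col i = v} := by
  rw [card_eq_sum_card_fiberwise (f := z) (t := univ) (by intro c hc; simp)]
  refine sum_congr rfl fun a _ => ?_
  rw [filter_filter, cnt]

theorem Balanced.sum_eq (hb : Balanced S col D) (h : ℕ → ℚ) :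
    ∑ i ∈ S, h i = ∑ v with IsNormalized v, ∑ i ∈ S with col i = v, h i :=
  (sum_fiberwise_of_maps_to (fun i hi => by simpa using hb.norm i hi) h).symm

theorem card_normalized_filter (Q : (Fin l → ZMod p) → Prop)
    (hQ : ∀ a : ZMod p, a ≠ 0 → ∀ v, Q (a • v) ↔ Q v) :
    ((p : ℚ) - 1) * #{v : Fin l → ZMod p | IsNormalized v ∧ Q v} =
      #{v : Fin l → ZMod p | v ≠ 0 ∧ Q v} := by
  rw [card_ne_zero_eq Q hQ, Nat.cast_mul, Nat.cast_sub (Fact.out : p.Prime).one_lt.le, Nat.cast_one]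

theorem card_normalized : ((p : ℚ) - 1) * #{v : Fin l → ZMod p | IsNormalized v} = (p : ℚ) ^ l - 1 := by
  have h := card_normalized_filter (p := p) (l := l) (fun _ => True) (by simp)
  simp only [and_true] at h
  rw [h, filter_ne', card_erase_of_mem (mem_univ _), card_univ, Fintype.card_fun, ZMod.card,
    Fintype.card_fin, Nat.cast_sub, Nat.cast_pow, Nat.cast_one]
  exact Nat.one_le_pow _ _ (Fact.out : p.Prime).pos

theorem Balanced.card_eq (hb : Balanced S col D) :
    ((p : ℚ) - 1) * #S = D * ((p : ℚ) ^ l - 1) := by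
  have h := hb.sum_eq (fun _ => 1)
  have h2 : ∀ v ∈ (univ.filter fun v : Fin l → ZMod p => IsNormalized v),
      ∑ i ∈ S with col i = v, (1 : ℚ) = D := by
    intro v hv
    simp [hb.card v (by simpa using hv)]
  rw [sum_congr rfl h2] at h
  simp only [sum_const, nsmul_eq_mul, mul_one] at h
  rw [h, ← card_normalized]
  ring

/-- Double counting of pairs (codeword in `Q`, agreeing position); all later bounds come from a
choice of `Q`. -/
theorem Avoids.sum_le (h : Avoids S col d t z) (Q : Finset (Fin l → ZMod p)) :
    (d : ℚ) * #Q + ∑ i ∈ S, (#{c ∈ Q | c ⬝ᵥ col i = z i} : ℚ) ≤ ((#S : ℚ) + t) * #Q := by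
  have h1 : ∑ i ∈ S, #{c ∈ Q | c ⬝ᵥ col i = z i} = ∑ c ∈ Q, #{i ∈ S | c ⬝ᵥ col i = z i} := by
    simp only [card_filter]
    exact sum_comm
  have h2 : ∑ c ∈ Q, (d + #{i ∈ S | c ⬝ᵥ col i = z i}) ≤ ∑ _c ∈ Q, (#S + t) :=
    sum_le_sum fun c _ => h c
  rw [sum_add_distrib, ← h1, sum_const, sum_const, smul_eq_mul, smul_eq_mul] at h2
  have h3 : ((#Q * d + ∑ i ∈ S, #{c ∈ Q | c ⬝ᵥ col i = z i} : ℕ) : ℚ) ≤ ((#Q * (#S + t) : ℕ) : ℚ) := by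
    exact_mod_cast h2
  push_cast at h3
  linarith

theorem p_pos : (0 : ℚ) < p := by exact_mod_cast (Fact.out : p.Prime).pos

theorem one_lt_p : (1 : ℚ) < p := by exact_mod_cast (Fact.out : p.Prime).one_lt

theorem card_dot_eq {u : Fin l → ZMod p} (hu : u ≠ 0) (a : ZMod p) :
    (#{c : Fin l → ZMod p | c ⬝ᵥ u = a} : ℚ) = (p : ℚ) ^ l / p := by
  have h := card_dotProduct_one hu {a}
  simp only [mem_singleton, card_singleton, mul_one] at h
  rw [eq_div_iff p_pos.ne']
  exact_mod_cast h

theorem card_dot_mem_pair {u v : Fin l → ZMod p} (h : LinearIndependent (ZMod p) ![u, v])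
    (s s' : Finset (ZMod p)) :
    (#{c : Fin l → ZMod p | c ⬝ᵥ u ∈ s ∧ c ⬝ᵥ v ∈ s'} : ℚ) = (p : ℚ) ^ l / p ^ 2 * (#s * #s') := by
  have h := card_dotProduct_two h s s'
  have hp : ((p : ℚ) ^ 2) ≠ 0 := pow_ne_zero _ p_pos.ne'
  rw [div_mul_eq_mul_div, eq_div_iff hp]
  exact_mod_cast h

theorem card_dot_mem_triple {u v w : Fin l → ZMod p} (h : LinearIndependent (ZMod p) ![u, v, w])
    (s s' s'' : Finset (ZMod p)) :
    (#{c : Fin l → ZMod p | c ⬝ᵥ u ∈ s ∧ c ⬝ᵥ v ∈ s' ∧ c ⬝ᵥ w ∈ s''} : ℚ) =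
      (p : ℚ) ^ l / p ^ 3 * (#s * #s' * #s'') := by
  have h := card_dotProduct_three h s s' s''
  have hp : ((p : ℚ) ^ 3) ≠ 0 := pow_ne_zero _ p_pos.ne'
  rw [div_mul_eq_mul_div, eq_div_iff hp]
  exact_mod_cast h

/-- At each position of `S` a fraction `1 / p` of all codewords agrees with `z`, so the average
agreement is `#S / p`. -/
theorem Avoids.lt_add (hb : Balanced S col D) (hpd : p * d = p ^ l * D) (h : Avoids S col d t z) :
    D ≤ p * t := by
  have h1 := h.sum_le univ
  have h2 : ∀ i ∈ S, (#{c : Fin l → ZMod p | c ⬝ᵥ col i = z i} : ℚ) = (p : ℚ) ^ l / p :=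
    fun i hi => card_dot_eq (hb.norm i hi).ne_zero _
  rw [sum_congr rfl h2, sum_const, card_univ, Fintype.card_fun, ZMod.card, Fintype.card_fin,
    nsmul_eq_mul] at h1
  push_cast at h1
  have hk : (0 : ℚ) < (p : ℚ) ^ l := pow_pos p_pos _
  have h3 : (p : ℚ) * d + #S ≤ p * (#S + t) := by
    have : (d : ℚ) + #S / p ≤ #S + t := by
      refine le_of_mul_le_mul_right ?_ hk
      calc _ = _ := by ring
        _ ≤ _ := h1
    have h4 := mul_le_mul_of_nonneg_left this (p_pos (p := p)).le
    rwa [mul_add, mul_div_cancel₀ _ p_pos.ne'] at h4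
  have h5 := hb.card_eq
  have h6 : (p : ℚ) * d = (p : ℚ) ^ l * D := by exact_mod_cast hpd
  have h7 : (D : ℚ) ≤ p * t := by linarith
  exact_mod_cast h7

/-- Average over the codewords with value `a` on the block of `v`. On that block they agree with `z`
exactly where `z` is `a`; on every other block independence leaves the average at `1 / p`. -/
theorem Avoids.cnt_le (hb : Balanced S col D) (hpd : p * d = p ^ l * D)
    (h : Avoids S col d t z) {v : Fin l → ZMod p} (hv : IsNormalized v) (a : ZMod p) :
    cnt S col z v a ≤ t := by
  set Q : Finset (Fin l → ZMod p) := {c | c ⬝ᵥ v = a} with hQ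
  have hQc : (#Q : ℚ) = (p : ℚ) ^ l / p := card_dot_eq hv.ne_zero a
  have hQpos : (0 : ℚ) < #Q := by rw [hQc]; exact div_pos (pow_pos p_pos _) p_pos
  have h1 := h.sum_le Q
  have h2 : ∑ i ∈ S, (#{c ∈ Q | c ⬝ᵥ col i = z i} : ℚ) =
      ∑ i ∈ S, (#Q / p + if col i = v then (if z i = a then (#Q : ℚ) else 0) - #Q / p else 0) := by
    refine sum_congr rfl fun i hi => ?_
    by_cases hiv : col i = v
    · rw [if_pos hiv, hiv]
      by_cases hia : z i = a
      · rw [if_pos hia, filter_true_of_mem]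
        · ring
        · intro c hc
          rw [hia]
          simpa [hQ] using hc
      · rw [if_neg hia, filter_false_of_mem]
        · simp
        · intro c hc h'
          apply hia
          rw [← h']
          simpa [hQ] using hc
    · rw [if_neg hiv, add_zero, hQc, hQ, filter_filter]
      have := card_dot_mem_pair (linearIndependent_pair_of_isNormalized hv (hb.norm i hi)
        (fun h => hiv h.symm)) {a} {z i}
      simp only [mem_singleton, card_singleton, Nat.cast_one, mul_one] at this
      rw [this]
      field_simp
  have h3 : ∑ i ∈ S, (if col i = v then (if z i = a then (#Q : ℚ) else 0) - #Q / p else 0) =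
      cnt S col z v a * #Q - D * (#Q / p) := by
    rw [← sum_filter, sum_sub_distrib, ← sum_filter, filter_filter, sum_const, sum_const,
      hb.card v hv, nsmul_eq_mul, nsmul_eq_mul, cnt]
  rw [h2, sum_add_distrib, h3, sum_const, nsmul_eq_mul] at h1
  have h4 : (p : ℚ) * d + #S + p * cnt S col z v a - D ≤ p * (#S + t) := by
    have : (d : ℚ) + (#S / p + (cnt S col z v a - D / p)) ≤ #S + t := by
      refine le_of_mul_le_mul_right ?_ hQpos
      calc _ = _ := by ring
        _ ≤ _ := h1
    have h4 := mul_le_mul_of_nonneg_left this (p_pos (p := p)).le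
    have hp := p_pos (p := p)
    calc (p : ℚ) * d + #S + p * cnt S col z v a - D
        = p * ((d : ℚ) + (#S / p + (cnt S col z v a - D / p))) := by field_simp; ring
      _ ≤ _ := h4
  have h5 := hb.card_eq
  have h6 : (p : ℚ) * d = (p : ℚ) ^ l * D := by exact_mod_cast hpd
  have h7 : (p : ℚ) * cnt S col z v a ≤ p * t := by linarith
  have h8 := le_of_mul_le_mul_left h7 p_pos
  exact_mod_cast h8

/-- If `z` is as concentrated as possible on the blocks of `u` and `v`, then it is so on the blocks
of all other points of the line through `u` and `v`. -/
theorem Avoids.cnt_line_le (hb : Balanced S col D) (hpd : p * d = p ^ l * D) (hD : D + m = p * t)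
    (h : Avoids S col d t z) {u v : Fin l → ZMod p} (hu : IsNormalized u)
    (hv : IsNormalized v) (huv : u ≠ v) (hline : ∀ s : ZMod p, IsNormalized (u + s • v))
    {α β : ZMod p} (hα : ∀ a, a ≠ α → t ≤ cnt S col z u a)
    (hβ : ∀ a, a ≠ β → t ≤ cnt S col z v a) (s : ZMod p) (hs : s ≠ 0) :
    cnt S col z (u + s • v) (α + s * β) + m ≤ t := by
  have hind := linearIndependent_pair_of_isNormalized hu hv huv
  set κ : ℚ := (p : ℚ) ^ l / p ^ 2 with hκ
  have hκ0 : 0 < κ := div_pos (pow_pos p_pos _) (pow_pos p_pos _)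
  have hcard1 : ∀ x : ZMod p, (#(univ.erase x) : ℚ) = p - 1 := by
    intro x
    rw [card_erase_of_mem (mem_univ _), card_univ, ZMod.card,
      Nat.cast_sub (Fact.out : p.Prime).one_lt.le, Nat.cast_one]
  -- Codewords that miss the scarce value on both blocks: they agree with `z` more often than
  -- average there, so the rest of the line must compensate. Here `κ` is the number of `c` with
  -- prescribed products with `u` and `v`.
  set Q : Finset (Fin l → ZMod p) := {c | c ⬝ᵥ u ∈ univ.erase α ∧ c ⬝ᵥ v ∈ univ.erase β} with hQ
  have hQc : (#Q : ℚ) = κ * ((p - 1) * (p - 1)) := by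
    rw [hQ, card_dot_mem_pair hind, hcard1, hcard1]
  have h1 := h.sum_le Q
  -- The base value `#Q / p` is exact for columns off the line, by independence of three vectors;
  -- the remaining terms correct it on the blocks of `u`, of `v` and of the points `u + x • v`.
  have hpt : ∀ i ∈ S,
      #Q / (p : ℚ) +
        ((if col i = u then (if z i = α then 0 else κ * (p - 1)) - #Q / p else 0) +
        (if col i = v then (if z i = β then 0 else κ * (p - 1)) - #Q / p else 0) +
        ∑ x ∈ univ.erase (0 : ZMod p), (if col i = u + x • v then
          (κ * (p - 2) + if z i = α + x * β then κ else 0) - #Q / p else 0)) ≤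
      (#{c ∈ Q | c ⬝ᵥ col i = z i} : ℚ) := by
    intro i hi
    have hline_ne : ∀ x : ZMod p, x ≠ 0 → u + x • v ≠ u := by
      intro x hx hx'
      have : x • v = 0 := by simpa using hx'
      exact (smul_ne_zero hx hv.ne_zero) this
    have hline_ne' : ∀ x : ZMod p, u + x • v ≠ v := by
      intro x hx
      refine huv (hu.eq_of_smul hv (a := 1 - x) ?_)
      rw [sub_smul, one_smul, eq_sub_iff_add_eq, hx]
    have hline_inj : ∀ x y : ZMod p, u + x • v = u + y • v → x = y := by
      intro x y hxy
      exact smul_left_injective _ hv.ne_zero (add_left_cancel hxy)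
    by_cases h1 : col i = u
    · have hz : ∑ x ∈ univ.erase (0 : ZMod p), (if col i = u + x • v then
          (κ * (p - 2) + if z i = α + x * β then κ else 0) - #Q / p else 0) = 0 :=
        sum_eq_zero fun x hx => if_neg fun hc =>
          hline_ne x (by simpa using hx) (hc.symm.trans h1)
      rw [hz, if_pos h1, if_neg (fun hc => huv (h1.symm.trans hc))]
      by_cases hzi : z i = α
      · simp [hzi]
      · rw [if_neg hzi]
        have : (#{c ∈ Q | c ⬝ᵥ col i = z i} : ℚ) = κ * (p - 1) := by
          have h2 := card_dot_mem_pair hind {z i} (univ.erase β)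
          rw [hcard1, card_singleton, Nat.cast_one, one_mul] at h2
          rw [← h2, hQ, filter_filter, h1]
          congr 2
          ext c
          simp only [mem_filter, mem_univ, true_and, mem_erase, and_true, mem_singleton]
          constructor
          · rintro ⟨⟨_, h4⟩, h5⟩
            exact ⟨h5, h4⟩
          · rintro ⟨h5, h4⟩
            exact ⟨⟨h5 ▸ hzi, h4⟩, h5⟩
        rw [this]
        apply le_of_eq
        ring
    by_cases h2 : col i = v
    · have hz : ∑ x ∈ univ.erase (0 : ZMod p), (if col i = u + x • v then
          (κ * (p - 2) + if z i = α + x * β then κ else 0) - #Q / p else 0) = 0 :=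
        sum_eq_zero fun x hx => if_neg fun hc => hline_ne' x (hc.symm.trans h2)
      rw [hz, if_pos h2, if_neg h1]
      by_cases hzi : z i = β
      · simp [hzi]
      · rw [if_neg hzi]
        have : (#{c ∈ Q | c ⬝ᵥ col i = z i} : ℚ) = κ * (p - 1) := by
          have h2' := card_dot_mem_pair hind (univ.erase α) {z i}
          rw [hcard1, card_singleton, Nat.cast_one, mul_one] at h2'
          rw [← h2', hQ, filter_filter, h2]
          congr 2
          ext c
          simp only [mem_filter, mem_univ, true_and, mem_erase, and_true, mem_singleton]
          constructor
          · rintro ⟨⟨h4, _⟩, h5⟩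
            exact ⟨h4, h5⟩
          · rintro ⟨h4, h5⟩
            exact ⟨⟨h4, h5 ▸ hzi⟩, h5⟩
        rw [this]
        apply le_of_eq
        ring
    rw [if_neg h1, if_neg h2]
    by_cases h3 : ∃ x : ZMod p, col i = u + x • v
    · obtain ⟨x, hx⟩ := h3
      have hx0 : x ≠ 0 := by
        rintro rfl
        exact h1 (by simpa using hx)
      rw [sum_eq_single_of_mem x (by simpa using hx0)
        (fun y _ hyx => if_neg fun hc => hyx (hline_inj _ _ (hc.symm.trans hx))), if_pos hx]
      have hind' : LinearIndependent (ZMod p) ![u, u + x • v] :=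
        linearIndependent_pair_of_isNormalized hu (hline x) (hline_ne x hx0).symm
      -- Given the product with `u + x • v`, avoiding `β` at `v` means avoiding `z i - x * β` at
      -- `u`. This exclusion coincides with that of `α` exactly when `z i = α + x * β`, which leaves
      -- one more choice.
      have hc := card_dot_mem_pair hind' ((univ.erase α).erase (z i - x * β)) {z i}
      have hset : (Q.filter fun c => c ⬝ᵥ col i = z i) = univ.filter fun c : Fin l → ZMod p =>
          c ⬝ᵥ u ∈ (univ.erase α).erase (z i - x * β) ∧ c ⬝ᵥ (u + x • v) ∈ ({z i} : Finset _) := by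
        ext c
        simp only [hQ, hx, mem_filter, mem_univ, true_and, mem_erase, and_true, mem_singleton,
          dotProduct_add, dotProduct_smul, smul_eq_mul]
        constructor
        · rintro ⟨⟨h5, h6⟩, h7⟩
          refine ⟨⟨fun h8 => h6 ?_, h5⟩, h7⟩
          rw [h8] at h7
          exact mul_left_cancel₀ hx0 (by linear_combination h7)
        · rintro ⟨⟨h5, h6⟩, h7⟩
          refine ⟨⟨h6, fun h8 => h5 ?_⟩, h7⟩
          rw [h8] at h7
          linear_combination h7
      rw [hset, hc, card_singleton, Nat.cast_one, mul_one, zero_add, zero_add, add_sub_cancel]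
      by_cases hz : z i = α + x * β
      · have : z i - x * β = α := by rw [hz]; ring
        rw [if_pos hz, this, erase_idem, hcard1]
        apply le_of_eq
        ring
      · have hne : z i - x * β ≠ α := by
          intro hc
          exact hz (by rw [← hc]; ring)
        rw [if_neg hz, card_erase_of_mem (by simpa using hne),
          Nat.cast_sub (card_pos.2 ⟨z i - x * β, by simpa using hne⟩), hcard1]
        apply le_of_eq
        push_cast
        ring
    · push Not at h3
      have hz : ∑ x ∈ univ.erase (0 : ZMod p), (if col i = u + x • v then
          (κ * (p - 2) + if z i = α + x * β then κ else 0) - #Q / p else 0) = 0 :=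
        sum_eq_zero fun x hx => if_neg (h3 x)
      rw [hz]
      have hc := card_dot_mem_triple (linearIndependent_triple_of_isNormalized hu hv (hb.norm i hi)
        huv hline h2 h3) (univ.erase α) (univ.erase β) {z i}
      rw [hcard1, hcard1, card_singleton, Nat.cast_one, mul_one] at hc
      have hset : (Q.filter fun c => c ⬝ᵥ col i = z i) = univ.filter fun c : Fin l → ZMod p =>
          c ⬝ᵥ u ∈ univ.erase α ∧ c ⬝ᵥ v ∈ univ.erase β ∧ c ⬝ᵥ col i ∈ ({z i} : Finset _) := by
        ext c
        simp only [hQ, mem_filter, mem_univ, true_and, mem_singleton, and_assoc]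
      rw [hset, hc, hQc, hκ]
      apply le_of_eq
      have := p_pos (p := p)
      field_simp
      ring
  have hsum := sum_le_sum hpt
  rw [sum_add_distrib, sum_add_distrib, sum_add_distrib, sum_comm (s := S), sum_const,
    nsmul_eq_mul] at hsum
  have hsu : ∀ (w : Fin l → ZMod p) (γ : ZMod p), IsNormalized w → (∀ a, a ≠ γ → t ≤ cnt S col z w a) →
      (κ * (p - 1) * ((p - 1) * t) - D * (#Q / p) : ℚ) ≤
        ∑ i ∈ S, if col i = w then (if z i = γ then 0 else κ * (p - 1)) - #Q / p else 0 := by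
    intro w γ hw hγ
    rw [← sum_filter, sum_sub_distrib, sum_const, hb.card w hw, nsmul_eq_mul]
    gcongr
    have e1 : ∑ i ∈ S with col i = w, (if z i = γ then 0 else κ * ((p : ℚ) - 1)) =
        ∑ a ∈ univ.erase γ, ∑ i ∈ S with col i = w ∧ z i = a, κ * ((p : ℚ) - 1) := by
      rw [← sum_fiberwise (s := S.filter fun i => col i = w) (g := z),
        ← add_sum_erase univ _ (mem_univ γ)]
      have : ∑ i ∈ (S.filter fun i => col i = w) with z i = γ, (if z i = γ then 0 else κ * ((p : ℚ) - 1)) = 0 :=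
        sum_eq_zero fun i hi => if_pos (mem_filter.1 hi).2
      rw [this, zero_add]
      refine sum_congr rfl fun a ha => ?_
      rw [filter_filter]
      refine sum_congr rfl fun i hi => if_neg ?_
      rw [(mem_filter.1 hi).2.2]
      exact (mem_erase.1 ha).1
    rw [e1]
    have e2 : ∀ a ∈ univ.erase γ, (t : ℚ) * (κ * ((p : ℚ) - 1)) ≤
        ∑ i ∈ S with col i = w ∧ z i = a, κ * ((p : ℚ) - 1) := by
      intro a ha
      rw [sum_const, nsmul_eq_mul]
      have h3 : (t : ℚ) ≤ #{i ∈ S | col i = w ∧ z i = a} := by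
        exact_mod_cast hγ a (mem_erase.1 ha).1
      have h4 := one_lt_p (p := p)
      have h5 : 0 ≤ κ * ((p : ℚ) - 1) := mul_nonneg hκ0.le (by linarith)
      exact mul_le_mul_of_nonneg_right h3 h5
    refine le_trans (le_of_eq ?_) (sum_le_sum e2)
    rw [sum_const, nsmul_eq_mul, hcard1]
    ring
  have hsx : ∀ x : ZMod p, ∑ i ∈ S, (if col i = u + x • v then
      (κ * (p - 2) + if z i = α + x * β then κ else 0) - #Q / p else 0) =
      D * (κ * (p - 2)) + κ * cnt S col z (u + x • v) (α + x * β) - D * (#Q / p) := by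
    intro x
    rw [← sum_filter, sum_sub_distrib, sum_add_distrib, ← sum_filter, filter_filter, sum_const,
      sum_const, sum_const, hb.card _ (hline x), nsmul_eq_mul, nsmul_eq_mul, nsmul_eq_mul, cnt]
    ring
  have hu1 := hsu u α hu hα
  have hv1 := hsu v β hv hβ
  rw [sum_congr rfl fun x _ => hsx x] at hsum
  rw [sum_sub_distrib, sum_add_distrib, sum_const, sum_const, nsmul_eq_mul, nsmul_eq_mul, hcard1,
    ← mul_sum] at hsum
  -- the counts on the other points of the line are bounded from below
  have hlow : ∀ x : ZMod p, (t : ℚ) - m ≤ cnt S col z (u + x • v) (α + x * β) := by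
    intro x
    have h3 := sum_cnt S col z (u + x • v)
    rw [hb.card _ (hline x), ← add_sum_erase univ _ (mem_univ (α + x * β))] at h3
    have h4 : ∑ a ∈ univ.erase (α + x * β), cnt S col z (u + x • v) a ≤
        ∑ a ∈ univ.erase (α + x * β), t :=
      sum_le_sum fun a _ => h.cnt_le hb hpd (hline x) a
    rw [sum_const, smul_eq_mul] at h4
    have h5 : ((∑ a ∈ univ.erase (α + x * β), cnt S col z (u + x • v) a : ℕ) : ℚ) ≤ (p - 1) * t := by
      rw [← hcard1 (α + x * β)]
      exact_mod_cast h4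
    have h6 : (cnt S col z (u + x • v) (α + x * β) : ℚ) +
      ((∑ a ∈ univ.erase (α + x * β), cnt S col z (u + x • v) a : ℕ) : ℚ) = D := by
      exact_mod_cast h3
    have h7 : (D : ℚ) + m = p * t := by exact_mod_cast hD
    linarith
  have hlow' : (cnt S col z (u + s • v) (α + s * β) : ℚ) + (p - 2) * (t - m) ≤
      ∑ x ∈ univ.erase (0 : ZMod p), (cnt S col z (u + x • v) (α + x * β) : ℚ) := by
    have hmem : s ∈ univ.erase (0 : ZMod p) := by simpa using hs
    rw [← add_sum_erase _ _ hmem]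
    gcongr
    have h3 : ∑ x ∈ (univ.erase (0 : ZMod p)).erase s, ((t : ℚ) - m) ≤
        ∑ x ∈ (univ.erase (0 : ZMod p)).erase s, (cnt S col z (u + x • v) (α + x * β) : ℚ) :=
      sum_le_sum fun x _ => hlow x
    refine le_trans (le_of_eq ?_) h3
    rw [sum_const, nsmul_eq_mul, card_erase_of_mem hmem, Nat.cast_sub (card_pos.2 ⟨s, hmem⟩),
      hcard1]
    push_cast
    ring
  have h5 := hb.card_eq
  have h6 : (p : ℚ) * d = (p : ℚ) ^ l * D := by exact_mod_cast hpd
  have h7 : (D : ℚ) + m = p * t := by exact_mod_cast hD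
  have hp := p_pos (p := p)
  have hp1 := one_lt_p (p := p)
  set T := ∑ x ∈ univ.erase (0 : ZMod p), (cnt S col z (u + x • v) (α + x * β) : ℚ)
  have hfin : (d : ℚ) * #Q + (#S * (#Q / p) + (2 * (κ * (p - 1) * ((p - 1) * t) - D * (#Q / p)) +
      ((p - 1) * (D * (κ * (p - 2))) + κ * T - (p - 1) * (D * (#Q / p))))) ≤ (#S + t) * #Q := by
    linarith
  rw [hQc] at hfin
  have hfin2 : (d : ℚ) * (p - 1) ^ 2 + (#S * ((p - 1) ^ 2 / p) + (2 * ((p - 1) * ((p - 1) * t) - D * ((p - 1) ^ 2 / p)) +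
      ((p - 1) * (D * (p - 2)) + T - (p - 1) * (D * ((p - 1) ^ 2 / p))))) ≤ (#S + t) * (p - 1) ^ 2 := by
    refine le_of_mul_le_mul_left ?_ hκ0
    calc _ = _ := by ring
      _ ≤ _ := hfin
      _ = _ := by ring
  have hd' : (d : ℚ) = (p : ℚ) ^ l * D / p := by rw [eq_div_iff hp.ne', ← h6]; ring
  have hS' : (#S : ℚ) = D * ((p : ℚ) ^ l - 1) / (p - 1) := by
    rw [eq_div_iff (by linarith), ← h5]; ring
  -- The right side is `(p - 1) * (t - m)`. As each of the `p - 1` summands of `T` is at least `t -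
  -- m`, none can exceed it.
  have hkey : T ≤ (p - 1) * (D - (p - 1) * t) := by
    have e : (d : ℚ) * (p - 1) ^ 2 + #S * ((p - 1) ^ 2 / p) - #S * (p - 1) ^ 2 = D * (p - 1) ^ 2 / p := by
      have hne : (p : ℚ) - 1 ≠ 0 := by linarith
      rw [hd', hS']
      field_simp
      ring
    have e2 : (D : ℚ) * (p - 1) ^ 2 / p + (- 2 * (D * ((p - 1) ^ 2 / p)) - (p - 1) * (D * ((p - 1) ^ 2 / p))) = - D * (p - 1) ^ 2 := by
      field_simp
      ring
    nlinarith [hfin2, e, e2]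
  have h8 : (cnt S col z (u + s • v) (α + s * β) : ℚ) + m ≤ t := by
    have : (D : ℚ) - (p - 1) * t = t - m := by linarith
    rw [this] at hkey
    linarith
  exact_mod_cast h8

end Averaging

/-! ### The forced multiplicities, and their sufficiency -/

section Concentration

variable {p : ℕ} [Fact p.Prime] {l : ℕ}
variable {S : Finset ℕ} {col : ℕ → Fin l → ZMod p} {D d t m : ℕ} {z : ℕ → ZMod p}

theorem card_erase_univ (x : ZMod p) : #(univ.erase x) = p - 1 := by
  rw [card_erase_of_mem (mem_univ _), card_univ, ZMod.card]

theorem pred_mul_add (t : ℕ) : (p - 1) * t + t = p * t := by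
  have := (Fact.out : p.Prime).pos
  conv_rhs => rw [← Nat.sub_add_cancel this]
  ring

theorem Balanced.cnt_add_le (hb : Balanced S col D) (hD : D + m = p * t) {v : Fin l → ZMod p}
    (hv : IsNormalized v) {γ : ZMod p} (h : ∀ a, a ≠ γ → t ≤ cnt S col z v a) :
    cnt S col z v γ + m ≤ t := by
  have h3 := sum_cnt S col z v
  rw [hb.card _ hv, ← add_sum_erase univ _ (mem_univ γ)] at h3
  have h4 : ∑ a ∈ univ.erase γ, t ≤ ∑ a ∈ univ.erase γ, cnt S col z v a :=
    sum_le_sum fun a ha => h a (mem_erase.1 ha).1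
  rw [sum_const, smul_eq_mul, card_erase_univ] at h4
  have := pred_mul_add (p := p) t
  omega

theorem Balanced.le_cnt_of_cnt_add_le (hb : Balanced S col D) (hD : D + m = p * t)
    {v : Fin l → ZMod p} (hv : IsNormalized v) (hle : ∀ a, cnt S col z v a ≤ t) {γ : ZMod p}
    (h : cnt S col z v γ + m ≤ t) (a : ZMod p) (ha : a ≠ γ) : t ≤ cnt S col z v a := by
  have h3 := sum_cnt S col z v
  have hmem : a ∈ univ.erase γ := by simpa using ha
  rw [hb.card _ hv, ← add_sum_erase univ _ (mem_univ γ), ← add_sum_erase _ _ hmem] at h3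
  have h4 : ∑ b ∈ (univ.erase γ).erase a, cnt S col z v b ≤ ∑ b ∈ (univ.erase γ).erase a, t :=
    sum_le_sum fun b _ => hle b
  rw [sum_const, smul_eq_mul, card_erase_of_mem hmem, card_erase_univ] at h4
  have := pred_mul_add (p := p) t
  have h5 : (p - 1 - 1) * t + t = (p - 1) * t := by
    have := (Fact.out : p.Prime).two_le
    have h6 : p - 1 = p - 1 - 1 + 1 := by omega
    conv_rhs => rw [h6]
    ring
  omega

/-- If `z` is concentrated on the blocks of the unit vectors in the support of `v`, then it is
concentrated on the block of `v`. -/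
theorem Avoids.cnt_neg_sum_add_le (h : Avoids S col d t z) (hb : Balanced S col D)
    (hpd : p * d = p ^ l * D) (hD : D + m = p * t) {v : Fin l → ZMod p} (hv : IsNormalized v)
    (hj : ∀ j, v j ≠ 0 → ∀ a : ZMod p, a ≠ -1 → t ≤ cnt S col z (Pi.single j 1) a) :
    cnt S col z v (-∑ i, v i) + m ≤ t := by
  induction hn : #{j | v j ≠ 0} using Nat.strong_induction_on generalizing v with
  | _ n ih =>
    obtain ⟨i, hi, hi'⟩ := hv
    by_cases hex : ∃ j, j ≠ i ∧ v j ≠ 0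
    · obtain ⟨j, hji, hvj⟩ := hex
      have hij : i < j := lt_of_le_of_ne (not_lt.1 fun hlt => hvj (hi' j hlt)) hji.symm
      -- `v` lies on the line through `u` and the unit vector at `j`, and `u` has smaller support.
      -- Choosing `j` after the leading index keeps every `u + s • e_j` normalized.
      set u := Function.update v j 0 with hu
      have huj : ∀ s : ZMod p, u + s • Pi.single j 1 = Function.update v j s := by
        intro s
        ext x
        by_cases hx : x = j
        · subst hx
          simp [hu]
        · simp [hu, hx]
      have hline : ∀ s : ZMod p, IsNormalized (u + s • Pi.single j 1) := by
        intro s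
        rw [huj]
        refine ⟨i, by rw [Function.update_of_ne hij.ne, hi], fun x hx => ?_⟩
        rw [Function.update_of_ne (hx.trans hij).ne, hi' x hx]
      have hun : IsNormalized u := by simpa using hline 0
      have huv : u ≠ Pi.single j 1 := by
        intro hc
        have := congrFun hc i
        simp [hu, hij.ne, hi] at this
      have hsum : ∑ x, v x = ∑ x, u x + v j := by
        rw [← add_sum_erase univ v (mem_univ j), ← add_sum_erase univ u (mem_univ j)]
        have : ∑ x ∈ univ.erase j, u x = ∑ x ∈ univ.erase j, v x :=
          sum_congr rfl fun x hx => Function.update_of_ne (mem_erase.1 hx).1 _ _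
        rw [this, hu, Function.update_self]
        ring
      have hlt : #{x | u x ≠ 0} < n := by
        rw [← hn]
        refine card_lt_card ⟨fun x hx => ?_, fun hsub => ?_⟩
        · simp only [mem_filter, mem_univ, true_and] at hx ⊢
          by_cases hxj : x = j
          · exact hxj ▸ hvj
          · rwa [hu, Function.update_of_ne hxj] at hx
        · have := hsub (show j ∈ univ.filter fun x => v x ≠ 0 by simpa using hvj)
          simp [hu] at this
      have hju : ∀ x, u x ≠ 0 → v x ≠ 0 := by
        intro x hx
        by_cases hxj : x = j
        · exact hxj ▸ hvj
        · rwa [hu, Function.update_of_ne hxj] at hx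
      have h1 := ih _ hlt hun (fun x hx => hj x (hju x hx)) rfl
      have h2 := h.cnt_line_le hb hpd hD hun (isNormalized_single j) huv hline
        (hb.le_cnt_of_cnt_add_le hD hun (fun a => h.cnt_le hb hpd hun a) h1) (hj j hvj) (v j) hvj
      rw [huj, Function.update_eq_self] at h2
      rwa [hsum, neg_add, ← mul_neg_one (v j)]
    · push Not at hex
      have hv : v = Pi.single i 1 := by
        ext x
        by_cases hx : x = i
        · subst hx
          simp [hi]
        · simp [hx, hex x hx]
      subst hv
      have := hb.cnt_add_le hD (isNormalized_single i) (hj i (by simp))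
      simpa using this

/-- The multiplicities of the greedy extension. -/
def nst (t m : ℕ) (v : Fin l → ZMod p) (a : ZMod p) : ℕ :=
  if a = -∑ i, v i then t - m else t

theorem sum_nst (hD : D + m = p * t) (hm : m ≤ t) (v : Fin l → ZMod p) : ∑ a, nst t m v a = D := by
  rw [← add_sum_erase univ _ (mem_univ (-∑ i, v i))]
  have : ∑ a ∈ univ.erase (-∑ i, v i), nst t m v a = ∑ a ∈ univ.erase (-∑ i, v i), t :=
    sum_congr rfl fun a ha => if_neg (mem_erase.1 ha).1
  rw [this, sum_const, smul_eq_mul, card_erase_univ, nst, if_pos rfl]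
  have := pred_mul_add (p := p) t
  omega

/-- The column `v` is extended by the entry `a` exactly `N v a` times. -/
def Distributed (S : Finset ℕ) (col : ℕ → Fin l → ZMod p) (N : (Fin l → ZMod p) → ZMod p → ℕ)
    (x : ℕ → ZMod p) : Prop :=
  ∀ v, IsNormalized v → ∀ a, cnt S col x v a = N v a

/-- A partial assignment exceeding no prescribed multiplicity can be completed one position at a
time: as the multiplicities on a block sum to its size, an unassigned position always leaves a value
below its quota. -/
theorem Balanced.exists_distributed (hb : Balanced S col D) {N : (Fin l → ZMod p) → ZMod p → ℕ}
    (hN : ∀ v, ∑ a, N v a = D) {P : Finset ℕ} (hP : P ⊆ S) (f : ℕ → ZMod p)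
    (hf : ∀ v, IsNormalized v → ∀ a, cnt P col f v a ≤ N v a) :
    ∃ x, (∀ i ∈ P, x i = f i) ∧ Distributed S col N x := by
  induction hn : #(S \ P) generalizing P f with
  | zero =>
    have hPS : P = S := subset_antisymm hP (by
      rw [card_eq_zero, sdiff_eq_empty_iff_subset] at hn
      exact hn)
    subst hPS
    refine ⟨f, fun i _ => rfl, fun v hv a => ?_⟩
    have h1 : ∑ a, cnt P col f v a = ∑ a, N v a := by rw [sum_cnt, hN, hb.card v hv]
    exact (sum_eq_sum_iff_of_le fun a _ => hf v hv a).1 h1 a (mem_univ a)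
  | succ n ih =>
    obtain ⟨i, hi⟩ : (S \ P).Nonempty := by
      rw [← card_pos]
      omega
    have hiS := (mem_sdiff.1 hi).1
    have hiP := (mem_sdiff.1 hi).2
    have hv := hb.norm i hiS
    obtain ⟨a, -, ha⟩ : ∃ a ∈ univ, cnt P col f (col i) a < N (col i) a := by
      refine exists_lt_of_sum_lt ?_
      rw [sum_cnt, hN, ← hb.card _ hv]
      refine card_lt_card ⟨filter_subset_filter _ hP, fun hsub => ?_⟩
      exact hiP (mem_filter.1 (hsub (mem_filter.2 ⟨hiS, rfl⟩))).1
    have hcnt : ∀ v b, cnt (insert i P) col (Function.update f i a) v b =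
        cnt P col f v b + if col i = v ∧ a = b then 1 else 0 := by
      intro v b
      unfold cnt
      have : (P.filter fun x => col x = v ∧ Function.update f i a x = b) =
          P.filter fun x => col x = v ∧ f x = b := by
        refine filter_congr fun x hx => ?_
        rw [Function.update_of_ne]
        rintro rfl
        exact hiP hx
      rw [filter_insert, Function.update_self, this]
      split_ifs
      · rw [card_insert_of_notMem]
        simp [hiP]
      · rfl
    obtain ⟨x, hx, hxd⟩ := ih (P := insert i P) (insert_subset hiS hP) (Function.update f i a)
      (by
        intro v hv b
        rw [hcnt]
        split_ifs with hc
        · obtain ⟨rfl, rfl⟩ := hc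
          exact ha
        · exact hf v hv b)
      (by
        have : S \ insert i P = (S \ P).erase i := by
          ext x
          simp only [mem_sdiff, mem_insert, mem_erase]
          tauto
        rw [this, card_erase_of_mem hi, hn]
        rfl)
    refine ⟨x, fun j hj => ?_, hxd⟩
    rw [hx j (mem_insert_of_mem hj), Function.update_of_ne]
    rintro rfl
    exact hiP hj

/-- The codeword of `c` agrees with `z` on the block of `v` in `t` positions, or in `t - m` if `(c +
1) ⬝ᵥ v = 0`. The latter condition holds at least on a hyperplane of points, which saves enough
agreements. -/
theorem Balanced.avoids_of_distributed (hb : Balanced S col D) (hpd : p * d = p ^ l * D)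
    (hD : D + m = p * t) (hm : m ≤ t) (h : Distributed S col (nst t m) z) :
    Avoids S col d t z := by
  intro c
  have hS := hb.card_eq
  have hM := card_normalized (p := p) (l := l)
  have hp := p_pos (p := p)
  have hp1 := one_lt_p (p := p)
  have hH : (p : ℚ) ^ l / p - 1 ≤
      (p - 1) * #{v : Fin l → ZMod p | IsNormalized v ∧ (c + 1) ⬝ᵥ v = 0} := by
    have h0 := card_normalized_filter (fun v : Fin l → ZMod p => (c + 1) ⬝ᵥ v = 0) (by
      intro a ha v
      simp [dotProduct_smul, ha])
    have h1 : ((p : ℚ) - 1) * #{v : Fin l → ZMod p | IsNormalized v ∧ (c + 1) ⬝ᵥ v = 0} =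
        #((univ.filter fun v : Fin l → ZMod p => v ⬝ᵥ (c + 1) = 0).erase 0) := by
      have hset : (univ.filter fun v : Fin l → ZMod p => v ⬝ᵥ (c + 1) = 0).erase 0 =
          univ.filter fun v : Fin l → ZMod p => v ≠ 0 ∧ (c + 1) ⬝ᵥ v = 0 := by
        ext v
        simp [dotProduct_comm]
      rw [hset]
      convert h0
    rw [h1, card_erase_of_mem (by simp), Nat.cast_sub (card_pos.2 ⟨0, by simp⟩), Nat.cast_one]
    gcongr
    -- For `c = -1` the condition holds for all `v`, and the bound only becomes slacker.
    by_cases hc : c + 1 = 0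
    · rw [hc]
      simp only [dotProduct_zero, filter_true, card_univ, Fintype.card_fun, ZMod.card,
        Fintype.card_fin, Nat.cast_pow]
      exact div_le_self (pow_nonneg hp.le _) hp1.le
    · rw [card_dot_eq hc]
  have hA : (#{i ∈ S | c ⬝ᵥ col i = z i} : ℚ) =
      t * #{v : Fin l → ZMod p | IsNormalized v} -
        m * #{v : Fin l → ZMod p | IsNormalized v ∧ (c + 1) ⬝ᵥ v = 0} := by
    rw [card_filter, Nat.cast_sum, hb.sum_eq]
    have h1 : ∀ v ∈ (univ.filter fun v : Fin l → ZMod p => IsNormalized v),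
        ∑ i ∈ S with col i = v, ((if c ⬝ᵥ col i = z i then 1 else 0 : ℕ) : ℚ) =
          t - if (c + 1) ⬝ᵥ v = 0 then (m : ℚ) else 0 := by
      intro v hv
      have hv' : IsNormalized v := by simpa using hv
      rw [← Nat.cast_sum, ← card_filter, filter_filter]
      have h2 : (S.filter fun i => col i = v ∧ c ⬝ᵥ col i = z i) =
          S.filter fun i => col i = v ∧ z i = c ⬝ᵥ v := by
        refine filter_congr fun i _ => and_congr_right fun hi => ?_
        rw [hi, eq_comm]
      rw [h2]
      have h3 := h v hv' (c ⬝ᵥ v)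
      unfold cnt at h3
      rw [h3, nst]
      have h4 : (c + 1) ⬝ᵥ v = 0 ↔ c ⬝ᵥ v = -∑ i, v i := by
        rw [add_dotProduct, one_dotProduct, add_eq_zero_iff_eq_neg]
      rw [if_congr h4 rfl rfl]
      split_ifs
      · rw [Nat.cast_sub hm]
      · rw [sub_zero]
    rw [sum_congr rfl h1, sum_sub_distrib, ← sum_filter, filter_filter, sum_const, sum_const,
      nsmul_eq_mul, nsmul_eq_mul]
    ring
  have h6 : (p : ℚ) * d = (p : ℚ) ^ l * D := by exact_mod_cast hpd
  have h7 : (D : ℚ) + m = p * t := by exact_mod_cast hD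
  have hfin : (d : ℚ) + #{i ∈ S | c ⬝ᵥ col i = z i} ≤ #S + t := by
    rw [hA]
    set M : ℚ := ((#{v : Fin l → ZMod p | IsNormalized v} : ℕ) : ℚ)
    set H : ℚ := ((#{v : Fin l → ZMod p | IsNormalized v ∧ (c + 1) ⬝ᵥ v = 0} : ℕ) : ℚ)
    have hpp : 0 < (p : ℚ) * (p - 1) := mul_pos hp (by linarith)
    refine le_of_mul_le_mul_left ?_ hpp
    have hH' : (p : ℚ) ^ l - p ≤ p * ((p - 1) * H) := by
      have := mul_le_mul_of_nonneg_left hH hp.le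
      calc (p : ℚ) ^ l - p = p * ((p : ℚ) ^ l / p - 1) := by field_simp
        _ ≤ _ := this
    have hmn : (0 : ℚ) ≤ m := Nat.cast_nonneg _
    have h8 := mul_le_mul_of_nonneg_left hH' hmn
    have e1 : (p : ℚ) * (p - 1) * (d + (t * M - m * H)) =
      (p - 1) * (p * d) + p * t * ((p - 1) * M) - m * (p * ((p - 1) * H)) := by ring
    have e2 : (p : ℚ) * (p - 1) * (#S + t) = p * ((p - 1) * #S) + (p - 1) * (p * t) := by ring
    rw [e1, e2, hM, hS, h6, ← h7]
    linarith
  exact_mod_cast hfin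

end Concentration

/-! ### Exchange arguments inside the support -/

section Exchange

variable {p : ℕ} [Fact p.Prime] {l : ℕ}
variable {S : Finset ℕ} {col : ℕ → Fin l → ZMod p} {D d t m : ℕ} {z zs : ℕ → ZMod p}

theorem val_lt_val_neg_one {a : ZMod p} (h : a ≠ -1) : a.val < (-1 : ZMod p).val := by
  have h1 : (-1 : ZMod p).val = p - 1 := by
    obtain ⟨n, hn⟩ : ∃ n, p = n + 1 := ⟨p - 1, (Nat.sub_add_cancel (Fact.out : p.Prime).pos).symm⟩
    subst hn
    simp [ZMod.val_neg_one n]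
  refine lt_of_le_of_ne ?_ fun hc => h (ZMod.val_injective p hc)
  have := ZMod.val_lt a
  omega

theorem not_val_neg_one_lt (a : ZMod p) : ¬ (-1 : ZMod p).val < a.val := by
  by_cases h : a = -1
  · simp [h]
  · exact (val_lt_val_neg_one h).le.not_gt

/-- Apart from the indices in `Ex`, the block of `v` lies below the blocks of the unit vectors in
the support of `v`. -/
def Layered (Ex S : Finset ℕ) (col : ℕ → Fin l → ZMod p) : Prop :=
  ∀ i ∈ S, i ∉ Ex → ∀ i' ∈ S, i' ∉ Ex → ∀ j, col i j ≠ 0 → col i' = Pi.single j 1 →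
    col i ≠ col i' → i < i'

theorem sub_le_nst (hm : m ≤ t) (v : Fin l → ZMod p) (a : ZMod p) : t - m ≤ nst t m v a := by
  unfold nst
  split_ifs <;> omega

theorem nst_single (t m : ℕ) (j : Fin l) {a : ZMod p} (ha : a ≠ -1) :
    nst t m (Pi.single j 1) a = t := by
  rw [nst, if_neg]
  simpa using ha

/-- The quota needed to complete the upper part of `z`. Only the scarce value is critical. Either
all relevant unit blocks are above `N`, and concentration propagates to the block of `N`; or
layering leaves only exceptional positions of this block to be counted, at most two. -/
theorem Avoids.card_le_nst (h : Avoids S col d t z) (hb : Balanced S col D)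
    (hpd : p * d = p ^ l * D) (hD : D + m = p * t) (hm : m + 2 ≤ t) {Ex : Finset ℕ}
    (hEx : #Ex ≤ 2) (hL : Layered Ex S col) {N : ℕ} (hN : N ∈ S)
    (hE : ∀ j, (∀ i ∈ S, i ∉ Ex → col i = Pi.single j 1 → N < i) → ∀ a : ZMod p, a ≠ -1 →
      t ≤ cnt S col z (Pi.single j 1) a)
    (hne : z N = -1 → ∀ j, col N ≠ Pi.single j 1) :
    #{i ∈ S | (N ≤ i ∨ i ∈ Ex) ∧ col i = col N ∧ z i = z N} ≤ nst t m (col N) (z N) := by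
  have hv := hb.norm N hN
  have hsub : #{i ∈ S | (N ≤ i ∨ i ∈ Ex) ∧ col i = col N ∧ z i = z N} ≤
      cnt S col z (col N) (z N) :=
    card_le_card fun i hi => by
      simp only [mem_filter] at hi ⊢
      exact ⟨hi.1, hi.2.2⟩
  by_cases hz : z N = -∑ i, col N i
  · rw [nst, if_pos hz]
    by_cases hall : ∀ j, col N j ≠ 0 → ∀ i ∈ S, i ∉ Ex → col i = Pi.single j 1 → N < i
    · have := h.cnt_neg_sum_add_le hb hpd hD hv fun j hj => hE j (hall j hj)
      rw [← hz] at this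
      omega
    · push Not at hall
      obtain ⟨j, hj, i', hi', hi'Ex, hi'j, hle⟩ := hall
      have hNj : col N ≠ col i' := by
        intro hc
        rw [hi'j] at hc
        refine hne ?_ j hc
        rw [hz, hc]
        simp
      have hsub' : (S.filter fun i => (N ≤ i ∨ i ∈ Ex) ∧ col i = col N ∧ z i = z N) ⊆ Ex := by
        intro i hi
        simp only [mem_filter] at hi
        obtain ⟨hiS, hiN, hic, -⟩ := hi
        by_contra hiEx
        have := hL i hiS hiEx i' hi' hi'Ex j (hic ▸ hj) hi'j (hic ▸ hNj)
        have := hiN.resolve_right hiEx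
        omega
      have := card_le_card hsub'
      omega
  · rw [nst, if_neg hz]
    exact hsub.trans (h.cnt_le hb hpd hv _)

theorem Distributed.swap {N : (Fin l → ZMod p) → ZMod p → ℕ} {x : ℕ → ZMod p}
    (h : Distributed S col N x) {i j : ℕ} (hi : i ∈ S) (hj : j ∈ S) (hij : col i = col j) :
    Distributed S col N fun a => x (Equiv.swap i j a) := by
  intro v hv a
  rw [← h v hv a, cnt, cnt]
  have hmem : ∀ b ∈ S, Equiv.swap i j b ∈ S ∧ col (Equiv.swap i j b) = col b := by
    intro b hb
    by_cases h1 : b = i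
    · subst h1
      rw [Equiv.swap_apply_left]
      exact ⟨hj, hij.symm⟩
    · by_cases h2 : b = j
      · subst h2
        rw [Equiv.swap_apply_right]
        exact ⟨hi, hij⟩
      · rw [Equiv.swap_apply_of_ne_of_ne h1 h2]
        exact ⟨hb, rfl⟩
  refine card_bij (fun b _ => Equiv.swap i j b) ?_ (fun _ _ _ _ h => (Equiv.swap i j).injective h) ?_
  · intro b hb
    simp only [mem_filter] at hb ⊢
    obtain ⟨h1, h2⟩ := hmem b hb.1
    exact ⟨h1, h2.trans hb.2.1, hb.2.2⟩
  · intro b hb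
    simp only [mem_filter] at hb
    obtain ⟨h1, h2⟩ := hmem b hb.1
    refine ⟨Equiv.swap i j b, ?_, Equiv.swap_apply_self i j b⟩
    simp only [mem_filter]
    exact ⟨h1, h2.trans hb.2.1, by rw [Equiv.swap_apply_self]; exact hb.2.2⟩

theorem Distributed.exists_eq (h : Distributed S col (nst t m) z) (hm : m < t)
    {v : Fin l → ZMod p} (hv : IsNormalized v) (a : ZMod p) : ∃ i ∈ S, col i = v ∧ z i = a := by
  have h1 := h v hv a
  have h2 := sub_le_nst hm.le v a
  have h3 : 0 < cnt S col z v a := by omega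
  obtain ⟨i, hi⟩ := card_pos.1 h3
  exact ⟨i, by simpa using hi⟩

/-- The greedy choice on the blocks, for an order that compares coordinates from the top, with the
coordinate at `η` compared after a shift by `φ`. -/
theorem Avoids.not_lt_of_shift (hz : Avoids S col d t z) (hb : Balanced S col D)
    (hpd : p * d = p ^ l * D) (hD : D + m = p * t) (hm : m + 2 ≤ t) {η : ℕ} {φ : ZMod p}
    (hL : Layered {η} S col) (hd : Distributed S col (nst t m) zs)
    (hmin : ∀ x, Distributed S col (nst t m) x → ∀ N ∈ S, (∀ i ∈ S, N < i → x i = zs i) →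
      ¬ (x N - if N = η then φ else 0).val < (zs N - if N = η then φ else 0).val)
    {N : ℕ} (hN : N ∈ S) (hag : ∀ i ∈ S, N < i → z i = zs i) :
    ¬ (z N - if N = η then φ else 0).val < (zs N - if N = η then φ else 0).val := by
  intro hlt
  -- Minimality makes the entries of `zs` within a block weakly decrease with the position, as long
  -- as the upper position is not `η`.
  have hswap : ∀ i ∈ S, ∀ j ∈ S, col i = col j → j < i → i ≠ η → ¬ (zs j).val < (zs i).val := by
    intro i hi j hj hij hji hiη hval
    refine hmin _ (hd.swap hi hj hij) i hi ?_ ?_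
    · intro b _ hb
      rw [Equiv.swap_apply_of_ne_of_ne (by omega) (by omega)]
    · rw [Equiv.swap_apply_left, if_neg hiη, sub_zero, sub_zero]
      exact hval
  have hE : ∀ j, (∀ i ∈ S, i ∉ ({η} : Finset ℕ) → col i = Pi.single j 1 → N < i) →
      ∀ a : ZMod p, a ≠ -1 → t ≤ cnt S col z (Pi.single j 1) a := by
    intro j hj a ha
    rw [← nst_single t m j ha, ← hd _ (isNormalized_single j) a]
    refine card_le_card fun i hi => ?_
    simp only [mem_filter] at hi ⊢
    obtain ⟨hiS, hic, hia⟩ := hi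
    refine ⟨hiS, hic, ?_⟩
    by_cases hNi : N < i
    · rw [hag i hiS hNi, hia]
    · exfalso
      -- The only unit-block position not above `N` could be `η`. If it carried `a ≠ -1`, swapping
      -- it with a position above `N` carrying `-1` would improve `zs`.
      have hiη : i = η := by
        by_contra hc
        exact hNi (hj i hiS (by simpa using hc) hic)
      obtain ⟨i0, hi0, hi0c, hi0z⟩ := hd.exists_eq (by omega) (isNormalized_single j) (-1)
      have hi0η : i0 ≠ η := by
        rintro rfl
        rw [hiη, hi0z] at hia
        exact ha hia.symm
      have hNi0 := hj i0 hi0 (by simpa using hi0η) hi0c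
      refine hswap i0 hi0 i hiS (hi0c.trans hic.symm) (by omega) hi0η ?_
      rw [hia, hi0z]
      exact val_lt_val_neg_one ha
  have hK : #{i ∈ S | N ≤ i ∧ col i = col N ∧ z i = z N} ≤ nst t m (col N) (z N) := by
    -- A value `-1` on a unit block can only be an improvement at `N = η`, where the shift makes it
    -- small. No other position from `N` upward in this block then carries `-1`, so the count is at
    -- most one.
    by_cases hne : z N = -1 → ∀ j, col N ≠ Pi.single j 1
    · refine le_trans (card_le_card fun i hi => ?_)
        (hz.card_le_nst hb hpd hD hm (Ex := {η}) (by simp) hL hN hE hne)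
      simp only [mem_filter] at hi ⊢
      exact ⟨hi.1, Or.inl hi.2.1, hi.2.2⟩
    · push Not at hne
      obtain ⟨hz1, j, hj⟩ := hne
      have hNη : N = η := by
        by_contra hc
        rw [if_neg hc, sub_zero, sub_zero, hz1] at hlt
        exact not_val_neg_one_lt _ hlt
      have hzsN : zs N ≠ -1 := by
        intro hc
        rw [hz1, hc] at hlt
        exact lt_irrefl _ hlt
      have hsub : (S.filter fun i => N ≤ i ∧ col i = col N ∧ z i = z N) ⊆ {N} := by
        intro i hi
        simp only [mem_filter, mem_singleton] at hi ⊢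
        obtain ⟨hiS, hNi, hic, hiz⟩ := hi
        by_contra hc
        have hlt' : N < i := by omega
        refine hswap i hiS N hN hic hlt' (by omega) ?_
        rw [← hag i hiS hlt', hiz, hz1]
        exact val_lt_val_neg_one hzsN
      have h1 := card_le_card hsub
      have h2 := sub_le_nst (show m ≤ t by omega) (col N) (z N)
      rw [card_singleton] at h1
      omega
  -- Completing the part of `z` from `N` upward gives a distributed word preceding `zs`.
  obtain ⟨x, hx, hxd⟩ := hb.exists_distributed (sum_nst hD (by omega))
    (filter_subset (fun i => N ≤ i) S) z (by
      intro v hv a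
      unfold cnt
      rw [filter_filter]
      by_cases hva : v = col N ∧ a = z N
      · obtain ⟨rfl, rfl⟩ := hva
        exact hK
      · rw [← hd v hv a]
        refine card_le_card fun i hi => ?_
        simp only [mem_filter] at hi ⊢
        obtain ⟨hiS, hNi, hic, hiz⟩ := hi
        refine ⟨hiS, hic, ?_⟩
        have hne : i ≠ N := by
          rintro rfl
          exact hva ⟨hic.symm, hiz.symm⟩
        rw [← hag i hiS (by omega), hiz])
  refine hmin x hxd N hN ?_ ?_
  · intro i hi hNi
    rw [hx i (by simp [hi, hNi.le]), hag i hi hNi]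
  · rwa [hx N (by simp [hN])]

/-- The coordinates by which the orders induced by the bases in the family are decided. -/
def key (c : ZMod p) (ξ η : ℕ) (x : ℕ → ZMod p) (i : ℕ) : ZMod p :=
  if i = η then x η - c * x ξ else x i

theorem key_of_ne (c : ZMod p) {ξ η : ℕ} (x : ℕ → ZMod p) {i : ℕ} (h : i ≠ η) :
    key c ξ η x i = x i := if_neg h

theorem key_self (c : ZMod p) (ξ η : ℕ) (x : ℕ → ZMod p) :
    key c ξ η x η = x η - c * x ξ := if_pos rfl

/-- The greedy choice on the blocks when the coordinate at `η` is compared to the one at `ξ`, which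
is lower and belongs to the same block: both positions receive the same value. -/
theorem Distributed.eq_of_coupled (hd : Distributed S col (nst t m) zs) (hb : Balanced S col D)
    (hD : D + m = p * t) (hm : m + 2 ≤ t) {ξ η : ℕ} (hξη : ξ < η) (hξ : ξ ∈ S) (hη : η ∈ S)
    (hcol : col ξ = col η)
    (hmin : ∀ x, Distributed S col (nst t m) x → ∀ N ∈ S,
      (∀ i ∈ S, N < i → key 1 ξ η x i = key 1 ξ η zs i) →
      ¬ (key 1 ξ η x N).val < (key 1 ξ η zs N).val) : zs ξ = zs η := by
  by_contra hne
  -- If `-1` occurs above `η` in the block, swapping it with whichever of `ξ`, `η` does not carry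
  -- `-1` improves `zs`. Otherwise `-1` is unused above `η`, its quota is at least two, and it can
  -- be put at both `ξ` and `η`, making the key at `η` zero.
  by_cases hex : ∃ i ∈ S, η < i ∧ col i = col η ∧ zs i = -1
  · obtain ⟨i, hi, hηi, hic, hiz⟩ := hex
    obtain ⟨e, he, hez⟩ : ∃ e, (e = ξ ∨ e = η) ∧ zs e ≠ -1 := by
      by_cases h1 : zs ξ = -1
      · exact ⟨η, Or.inr rfl, fun hc => hne (h1.trans hc.symm)⟩
      · exact ⟨ξ, Or.inl rfl, h1⟩
    have heS : e ∈ S := by rcases he with rfl | rfl <;> assumption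
    have hec : col e = col η := by rcases he with rfl | rfl <;> simp [hcol]
    have hei : e < i := by rcases he with rfl | rfl <;> omega
    refine hmin _ (hd.swap hi heS (hic.trans hec.symm)) i hi ?_ ?_
    · intro b _ hib
      rw [key_of_ne _ _ (by omega), key_of_ne _ _ (by omega),
        Equiv.swap_apply_of_ne_of_ne (by omega) (by omega)]
    · rw [key_of_ne _ _ (by omega), key_of_ne _ _ (by omega), Equiv.swap_apply_left, hiz]
      exact val_lt_val_neg_one hez
  · push Not at hex
    obtain ⟨x, hx, hxd⟩ := hb.exists_distributed (sum_nst hD (by omega))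
      (filter_subset (fun i => η < i ∨ i = ξ ∨ i = η) S) (fun i => if η < i then zs i else -1) (by
        intro v hv a
        unfold cnt
        rw [filter_filter]
        by_cases hva : v = col η ∧ a = -1
        · obtain ⟨rfl, rfl⟩ := hva
          refine le_trans (card_le_card (t := {ξ, η}) fun i hi => ?_) (le_trans card_le_two
            (le_trans (by omega) (sub_le_nst (show m ≤ t by omega) _ _)))
          simp only [mem_filter] at hi
          obtain ⟨hiS, hi1, hic, hiz⟩ := hi
          rcases hi1 with hlt | hi1
          · rw [if_pos hlt] at hiz
            exact absurd hiz (hex i hiS hlt hic)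
          · simpa using hi1
        · rw [← hd v hv a]
          refine card_le_card fun i hi => ?_
          simp only [mem_filter] at hi ⊢
          obtain ⟨hiS, hi1, hic, hiz⟩ := hi
          by_cases hlt : η < i
          · rw [if_pos hlt] at hiz
            exact ⟨hiS, hic, hiz⟩
          · rw [if_neg hlt] at hiz
            have : col i = col η := by
              rcases hi1.resolve_left hlt with rfl | rfl
              · exact hcol
              · rfl
            exact absurd ⟨hic ▸ this, hiz.symm⟩ hva)
    have hxξ : x ξ = -1 := by
      rw [hx ξ (by simp [hξ])]
      exact if_neg (by omega)
    have hxη : x η = -1 := by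
      rw [hx η (by simp [hη])]
      exact if_neg (by omega)
    refine hmin x hxd η hη ?_ ?_
    · intro i hi hlt
      rw [key_of_ne _ _ (by omega), key_of_ne _ _ (by omega), hx i (by simp [hi, hlt])]
      exact if_pos hlt
    · rw [key_self, key_self, hxξ, hxη, one_mul, one_mul, sub_self, ZMod.val_zero, ZMod.val_pos,
        sub_ne_zero]
      exact fun hc => hne hc.symm

/-- If the common entry at `ξ` and `η` were not `-1`, two positions carrying `-1` could be swapped
with `ξ` and `η` simultaneously. The key at `η` stays zero and the higher of the two positions,
which is above `ξ`, improves. -/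
theorem Distributed.eq_neg_one_of_coupled (hd : Distributed S col (nst t m) zs)
    (hb : Balanced S col D) (hm : m + 2 ≤ t) {ξ η : ℕ} (hξη : ξ < η) (hξ : ξ ∈ S)
    (hη : η ∈ S) (hcol : col ξ = col η) (heq : zs ξ = zs η)
    (hmin : ∀ x, Distributed S col (nst t m) x → ∀ N ∈ S,
      (∀ i ∈ S, N < i → key 1 ξ η x i = key 1 ξ η zs i) →
      ¬ (key 1 ξ η x N).val < (key 1 ξ η zs N).val)
    {κ : ℕ} (hκ : κ ∈ S) (hξκ : ξ < κ) (hκc : col κ = col ξ) (hκz : zs κ = -1) :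
    zs ξ = -1 := by
  by_contra hne
  set K : Finset ℕ := {i ∈ S | col i = col ξ ∧ zs i = -1} with hK
  have hKmem : ∀ i ∈ K, i ∈ S ∧ col i = col ξ ∧ zs i = -1 := fun i hi => by simpa [hK] using hi
  have hKc : 2 ≤ #K := by
    have h1 := hd (col ξ) (hb.norm ξ hξ) (-1)
    have h2 := sub_le_nst (show m ≤ t by omega) (col ξ) (-1 : ZMod p)
    change #K = _ at h1
    omega
  have hκK : κ ∈ K := by simp [hK, hκ, hκc, hκz]
  have hKξ : ∀ i ∈ K, i ≠ ξ := by
    rintro i hi rfl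
    exact hne (hKmem i hi).2.2
  have hKη : ∀ i ∈ K, i ≠ η := by
    rintro i hi rfl
    exact hne (heq.trans (hKmem i hi).2.2)
  set κ₁ := K.max' ⟨κ, hκK⟩ with hκ₁
  have hκ₁K : κ₁ ∈ K := max'_mem _ _
  have hκ₁κ : κ ≤ κ₁ := le_max' _ _ hκK
  obtain ⟨κ₂, hκ₂⟩ : (K.erase κ₁).Nonempty := by
    rw [← card_pos, card_erase_of_mem hκ₁K]
    omega
  have hκ₂K := (mem_erase.1 hκ₂).2
  have hκ₂ne := (mem_erase.1 hκ₂).1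
  have hκ₂lt : κ₂ < κ₁ := lt_of_le_of_ne (le_max' _ _ hκ₂K) hκ₂ne
  have h1 := hKmem _ hκ₁K
  have h2 := hKmem _ hκ₂K
  have n1 := hKξ _ hκ₁K
  have n2 := hKξ _ hκ₂K
  have n3 := hKη _ hκ₁K
  have n4 := hKη _ hκ₂K
  refine hmin _ ((hd.swap h1.1 hξ h1.2.1).swap h2.1 hη (h2.2.1.trans hcol)) κ₁ h1.1 ?_ ?_
  · intro i _ hi
    by_cases hiη : i = η
    · subst hiη
      rw [key_self, key_self, Equiv.swap_apply_right, Equiv.swap_apply_of_ne_of_ne hκ₂ne n2,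
        Equiv.swap_apply_of_ne_of_ne n2.symm hξη.ne, Equiv.swap_apply_right, h1.2.2, h2.2.2, heq]
      ring
    · rw [key_of_ne _ _ hiη, key_of_ne _ _ hiη, Equiv.swap_apply_of_ne_of_ne (by omega) hiη,
        Equiv.swap_apply_of_ne_of_ne (by omega) (by omega)]
  · rw [key_of_ne _ _ n3, key_of_ne _ _ n3, Equiv.swap_apply_of_ne_of_ne hκ₂ne.symm n3,
      Equiv.swap_apply_left, h1.2.2]
    exact val_lt_val_neg_one hne

/-- The key at `η` involves the lower entry at `ξ`, so an upper part of `z` fixes a difference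
rather than the entry at `η`. For `N` above `ξ` the completion may therefore choose a new common
entry at `ξ` and `η`. -/
theorem Avoids.not_lt_of_coupled (hz : Avoids S col d t z) (hb : Balanced S col D)
    (hpd : p * d = p ^ l * D) (hD : D + m = p * t) (hm : m + 2 ≤ t) {ξ η : ℕ} (hξη : ξ < η)
    (hξ : ξ ∈ S) (hη : η ∈ S) (hcol : col ξ = col η)
    (hL : Layered {ξ, η} S col) (hd : Distributed S col (nst t m) zs)
    (hmin : ∀ x, Distributed S col (nst t m) x → ∀ N ∈ S,
      (∀ i ∈ S, N < i → key 1 ξ η x i = key 1 ξ η zs i) →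
      ¬ (key 1 ξ η x N).val < (key 1 ξ η zs N).val)
    {N : ℕ} (hN : N ∈ S) (hag : ∀ i ∈ S, N < i → key 1 ξ η z i = key 1 ξ η zs i) :
    ¬ (key 1 ξ η z N).val < (key 1 ξ η zs N).val := by
  intro hlt
  have heq := hd.eq_of_coupled hb hD hm hξη hξ hη hcol hmin
  have hneg : ∀ κ ∈ S, ξ < κ → col κ = col ξ → zs κ = -1 → zs ξ = -1 := fun κ hκ h1 h2 h3 =>
    hd.eq_neg_one_of_coupled hb hm hξη hξ hη hcol heq hmin hκ h1 h2 h3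
  have hkeyη : key 1 ξ η zs η = 0 := by rw [key_self, heq]; ring
  have hNη : N ≠ η := by
    rintro rfl
    rw [hkeyη, ZMod.val_zero] at hlt
    exact absurd hlt (Nat.not_lt_zero _)
  have hag' : ∀ i ∈ S, N < i → i ≠ η → z i = zs i := by
    intro i hi hNi hiη
    have := hag i hi hNi
    rwa [key_of_ne _ _ hiη, key_of_ne _ _ hiη] at this
  have hagη : N < ξ → z η = zs η := by
    intro h
    have h1 := hag η hη (h.trans hξη)
    rw [key_self, key_self, hag' ξ hξ h hξη.ne] at h1
    linear_combination h1
  rw [key_of_ne _ _ hNη, key_of_ne _ _ hNη] at hlt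
  have hE : ∀ j, (∀ i ∈ S, i ∉ ({ξ, η} : Finset ℕ) → col i = Pi.single j 1 → N < i) →
      ∀ a : ZMod p, a ≠ -1 → t ≤ cnt S col z (Pi.single j 1) a := by
    intro j hj a ha
    rw [← nst_single t m j ha, ← hd _ (isNormalized_single j) a]
    refine card_le_card fun i hi => ?_
    simp only [mem_filter] at hi ⊢
    obtain ⟨hiS, hic, hia⟩ := hi
    refine ⟨hiS, hic, ?_⟩
    by_cases hiEx : i ∈ ({ξ, η} : Finset ℕ)
    · have hi2 : i = ξ ∨ i = η := by simpa using hiEx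
      have hξa : zs ξ = a := by
        rcases hi2 with rfl | rfl
        · exact hia
        · exact heq.trans hia
      have hξc : col ξ = Pi.single j 1 := by
        rcases hi2 with rfl | rfl
        · exact hic
        · exact hcol.trans hic
      by_cases hNξ : N < ξ
      · rw [← hia]
        rcases hi2 with rfl | rfl
        · exact hag' _ hiS hNξ hξη.ne
        · exact hagη hNξ
      · exfalso
        obtain ⟨i0, hi0, hi0c, hi0z⟩ := hd.exists_eq (by omega) (isNormalized_single j) (-1)
        have h1 : i0 ≠ ξ := by
          rintro rfl
          exact ha (hξa.symm.trans hi0z)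
        have h2 : i0 ≠ η := by
          rintro rfl
          exact ha (hξa.symm.trans (heq.trans hi0z))
        have h3 := hj i0 hi0 (by simp [h1, h2]) hi0c
        exact ha (hξa.symm.trans (hneg i0 hi0 (by omega) (hi0c.trans hξc.symm) hi0z))
    · have hi2 : i ≠ ξ ∧ i ≠ η := by simpa using hiEx
      rw [hag' i hiS (hj i hiS hiEx hic) hi2.2, hia]
  have hK := hz.card_le_nst hb hpd hD hm (Ex := {ξ, η}) card_le_two hL hN hE (by
    intro h1
    rw [h1] at hlt
    exact absurd hlt (not_val_neg_one_lt _))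
  -- Here both coupled positions belong to the part from `N` upward, so the entries of `z` itself
  -- are kept.
  by_cases hNξ : N ≤ ξ
  · obtain ⟨x, hx, hxd⟩ := hb.exists_distributed (sum_nst hD (by omega))
      (filter_subset (fun i => N ≤ i) S) z (by
        intro v hv a
        unfold cnt
        rw [filter_filter]
        by_cases hva : v = col N ∧ a = z N
        · obtain ⟨rfl, rfl⟩ := hva
          refine le_trans (card_le_card fun i hi => ?_) hK
          simp only [mem_filter] at hi ⊢
          exact ⟨hi.1, Or.inl hi.2.1, hi.2.2⟩
        · rw [← hd v hv a]
          refine card_le_card fun i hi => ?_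
          simp only [mem_filter] at hi ⊢
          obtain ⟨hiS, hNi, hic, hiz⟩ := hi
          refine ⟨hiS, hic, ?_⟩
          have hne : i ≠ N := by
            rintro rfl
            exact hva ⟨hic.symm, hiz.symm⟩
          rw [← hiz]
          by_cases hiη : i = η
          · subst hiη
            rcases hNξ.lt_or_eq with hlt' | rfl
            · exact (hagη hlt').symm
            -- For `N = ξ` the vanishing key at `η` gives `z η = z N`, so this entry falls under the
            -- quota already checked by `hK`.
            · exfalso
              have h1 := hag i hiS (by omega)
              rw [hkeyη, key_self, one_mul, sub_eq_zero] at h1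
              exact hva ⟨(hcol.trans hic).symm, hiz.symm.trans h1⟩
          · exact (hag' i hiS (by omega) hiη).symm)
    have hx' : ∀ i ∈ S, N ≤ i → key 1 ξ η x i = key 1 ξ η z i := by
      intro i hi hNi
      by_cases hiη : i = η
      · subst hiη
        rw [key_self, key_self, hx _ (by simp [hi, hNi]), hx ξ (by simp [hξ, hNξ])]
      · rw [key_of_ne _ _ hiη, key_of_ne _ _ hiη, hx _ (by simp [hi, hNi])]
    refine hmin x hxd N hN (fun i hi hNi => (hx' i hi hNi.le).trans (hag i hi hNi)) ?_
    rw [hx' N hN le_rfl, key_of_ne _ _ hNη, key_of_ne _ _ hNη]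
    exact hlt
  · push Not at hNξ
    obtain ⟨c, hc⟩ : ∃ c : ZMod p, ∀ v, IsNormalized v → ∀ a,
        cnt (S.filter fun i => N ≤ i ∨ i ∈ ({ξ, η} : Finset ℕ)) col
          (fun i => if i ∈ ({ξ, η} : Finset ℕ) then c else z i) v a ≤ nst t m v a := by
      have hExc : ∀ i ∈ ({ξ, η} : Finset ℕ), col i = col ξ ∧ zs i = zs ξ := by
        intro i hi
        rcases (by simpa using hi : i = ξ ∨ i = η) with rfl | rfl
        · exact ⟨rfl, rfl⟩
        · exact ⟨hcol.symm, heq.symm⟩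
      have hag'' : ∀ i ∈ S, i ∉ ({ξ, η} : Finset ℕ) → N ≤ i → ∀ v a, ¬ (v = col N ∧ a = z N) →
          col i = v → z i = a → zs i = a ∧ ξ < i := by
        intro i hi hiEx hNi v a hva hic hiz
        have hne : i ≠ N := by
          rintro rfl
          exact hva ⟨hic.symm, hiz.symm⟩
        have hiη : i ≠ η := by
          rintro rfl
          simp at hiEx
        exact ⟨by rw [← hag' i hi (by omega) hiη, hiz], by omega⟩
      -- The common entry is normally that of `zs`. If this is also the value used by `z` at `N` in
      -- the same block, its quota might be exceeded, so `-1` is used instead: by `hneg` it does not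
      -- occur above `ξ` in the block, and its quota is at least two.
      by_cases hsame : col N = col ξ ∧ z N = zs ξ
      · have hne1 : zs ξ ≠ -1 := by
          intro h1
          rw [hsame.2, h1] at hlt
          exact not_val_neg_one_lt _ hlt
        refine ⟨-1, fun v hv a => ?_⟩
        unfold cnt
        rw [filter_filter]
        by_cases hva : v = col N ∧ a = z N
        · obtain ⟨rfl, rfl⟩ := hva
          refine le_trans (card_le_card fun i hi => ?_) hK
          simp only [mem_filter] at hi ⊢
          obtain ⟨hiS, hi1, hic, hiz⟩ := hi
          by_cases hiEx : i ∈ ({ξ, η} : Finset ℕ)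
          · rw [if_pos hiEx] at hiz
            exact absurd (hsame.2.symm.trans hiz.symm) hne1
          · rw [if_neg hiEx] at hiz
            exact ⟨hiS, hi1, hic, hiz⟩
        · by_cases hva' : v = col ξ ∧ a = -1
          · obtain ⟨rfl, rfl⟩ := hva'
            refine le_trans (card_le_card (t := {ξ, η}) fun i hi => ?_) (le_trans card_le_two
              (le_trans (by omega) (sub_le_nst (show m ≤ t by omega) _ _)))
            simp only [mem_filter] at hi
            obtain ⟨hiS, hi1, hic, hiz⟩ := hi
            by_contra hiEx
            rw [if_neg hiEx] at hiz
            obtain ⟨h1, h2⟩ := hag'' i hiS hiEx (hi1.resolve_right hiEx) _ _ hva hic hiz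
            exact hne1 (hneg i hiS h2 hic h1)
          · rw [← hd v hv a]
            refine card_le_card fun i hi => ?_
            simp only [mem_filter] at hi ⊢
            obtain ⟨hiS, hi1, hic, hiz⟩ := hi
            by_cases hiEx : i ∈ ({ξ, η} : Finset ℕ)
            · rw [if_pos hiEx] at hiz
              exact absurd ⟨hic.symm.trans (hExc i hiEx).1, hiz.symm⟩ hva'
            · rw [if_neg hiEx] at hiz
              exact ⟨hiS, hic, (hag'' i hiS hiEx (hi1.resolve_right hiEx) _ _ hva hic hiz).1⟩
      · refine ⟨zs ξ, fun v hv a => ?_⟩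
        unfold cnt
        rw [filter_filter]
        by_cases hva : v = col N ∧ a = z N
        · obtain ⟨rfl, rfl⟩ := hva
          refine le_trans (card_le_card fun i hi => ?_) hK
          simp only [mem_filter] at hi ⊢
          obtain ⟨hiS, hi1, hic, hiz⟩ := hi
          by_cases hiEx : i ∈ ({ξ, η} : Finset ℕ)
          · rw [if_pos hiEx] at hiz
            exact absurd ⟨hic.symm.trans (hExc i hiEx).1, hiz.symm⟩ hsame
          · rw [if_neg hiEx] at hiz
            exact ⟨hiS, hi1, hic, hiz⟩
        · rw [← hd v hv a]
          refine card_le_card fun i hi => ?_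
          simp only [mem_filter] at hi ⊢
          obtain ⟨hiS, hi1, hic, hiz⟩ := hi
          by_cases hiEx : i ∈ ({ξ, η} : Finset ℕ)
          · rw [if_pos hiEx] at hiz
            exact ⟨hiS, hic, (hExc i hiEx).2.trans hiz⟩
          · rw [if_neg hiEx] at hiz
            exact ⟨hiS, hic, (hag'' i hiS hiEx (hi1.resolve_right hiEx) _ _ hva hic hiz).1⟩
    obtain ⟨x, hx, hxd⟩ := hb.exists_distributed (sum_nst hD (by omega)) (filter_subset _ S) _ hc
    have hxξ : x ξ = c := by
      rw [hx ξ (by simp [hξ])]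
      simp
    have hxη : x η = c := by
      rw [hx η (by simp [hη])]
      simp
    have hx' : ∀ i ∈ S, N ≤ i → i ≠ η → x i = z i := by
      intro i hi hNi hiη
      rw [hx i (by simp [hi, hNi])]
      exact if_neg (by simp [hiη]; omega)
    refine hmin x hxd N hN ?_ ?_
    · intro i hi hNi
      by_cases hiη : i = η
      · subst hiη
        rw [hkeyη, key_self, hxξ, hxη]
        ring
      · rw [key_of_ne _ _ hiη, key_of_ne _ _ hiη, hx' i hi hNi.le hiη, hag' i hi hNi hiη]
    · rw [key_of_ne _ _ hNη, key_of_ne _ _ hNη, hx' N hN le_rfl hNη]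
      exact hlt

end Exchange

/-! ### One greedy step: locating the new coordinates -/

section Step

variable {p : ℕ} [Fact p.Prime] {l : ℕ}
variable {S O : Finset ℕ} {col : ℕ → Fin l → ZMod p} {D d t m : ℕ} {c : ZMod p} {ξ η : ℕ}

/-- The strict order on sequences that compares their keys from the top. -/
def KeyLT (c : ZMod p) (ξ η : ℕ) (x y : ℕ → ZMod p) : Prop :=
  ∃ N, (key c ξ η x N).val < (key c ξ η y N).val ∧ ∀ i, N < i → key c ξ η x i = key c ξ η y i

/-- The sequences at distance at least `d` from the row space of the matrix with columns `col`. -/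
def admissible (S : Finset ℕ) (col : ℕ → Fin l → ZMod p) (d : ℕ) : Set (Vec p) :=
  {z | ∀ v : Fin l → ZMod p, d ≤ #{i ∈ S | v ⬝ᵥ col i ≠ z i} + #(z.support \ S)}

/-- The sequences that are `1` on `O`, vanish outside `S ∪ O`, and have prescribed multiplicities
on the blocks. -/
def candidates (S O : Finset ℕ) (col : ℕ → Fin l → ZMod p) (t m : ℕ) : Set (Vec p) :=
  {x | (∀ i ∈ O, x i = 1) ∧ (∀ i, i ∉ S → i ∉ O → x i = 0) ∧ Distributed S col (nst t m) x}

/-- The sequence that agrees with `f` on `S`, is `1` on `O \ S`, and vanishes elsewhere. -/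
def glue (S O : Finset ℕ) (f : ℕ → ZMod p) : Vec p :=
  Finsupp.onFinset (S ∪ O) (fun i => if i ∈ S then f i else if i ∈ O then 1 else 0) (by
    intro i hi
    rw [mem_union]
    by_contra hc
    push Not at hc
    simp [hc.1, hc.2] at hi)

theorem glue_of_mem (O : Finset ℕ) (f : ℕ → ZMod p) {i : ℕ} (h : i ∈ S) : glue S O f i = f i := by
  simp [glue, h]

theorem Distributed.congr {N : (Fin l → ZMod p) → ZMod p → ℕ} {x y : ℕ → ZMod p}
    (h : Distributed S col N x) (hxy : ∀ i ∈ S, y i = x i) : Distributed S col N y := by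
  intro v hv a
  rw [← h v hv a]
  exact congrArg card (filter_congr fun i hi => by rw [hxy i hi])

theorem glue_mem_candidates (hdisj : Disjoint S O) {f : ℕ → ZMod p}
    (hf : Distributed S col (nst t m) f) : glue S O f ∈ candidates S O col t m := by
  refine ⟨fun i hi => ?_, fun i h1 h2 => by simp [glue, h1, h2], hf.congr fun i hi => glue_of_mem O f hi⟩
  have := disjoint_right.1 hdisj hi
  simp [glue, hi, this]

theorem glue_eq_of_notMem {x : Vec p} (hx : x ∈ candidates S O col t m) (f : ℕ → ZMod p) {i : ℕ}
    (h : i ∉ S) : glue S O f i = x i := by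
  by_cases hi : i ∈ O
  · rw [hx.1 i hi]
    simp [glue, h, hi]
  · rw [hx.2.1 i h hi]
    simp [glue, h, hi]

theorem mem_admissible_iff {z : Vec p} :
    z ∈ admissible S col d ↔ Avoids S col d #(z.support \ S) z := by
  refine forall_congr' fun v => ?_
  have := card_filter_add_card_filter_not (s := S) (fun i => v ⬝ᵥ col i = z i)
  simp only [ne_eq]
  omega

theorem candidates_subset_admissible (hb : Balanced S col D) (hpd : p * d = p ^ l * D)
    (hD : D + m = p * t) (hm : m ≤ t) (hO : #O = t) (hdisj : Disjoint S O) :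
    candidates S O col t m ⊆ admissible S col d := by
  rintro x ⟨h1, h2, h3⟩
  rw [mem_admissible_iff]
  have : x.support \ S = O := by
    ext i
    rw [mem_sdiff, Finsupp.mem_support_iff]
    constructor
    · rintro ⟨h4, h5⟩
      by_contra h6
      exact h4 (h2 i h5 h6)
    · intro h4
      exact ⟨by simp [h1 i h4], disjoint_right.1 hdisj h4⟩
  rw [this, hO]
  exact hb.avoids_of_distributed hpd hD hm h3

theorem candidates_nonempty (hb : Balanced S col D) (hD : D + m = p * t) (hm : m ≤ t)
    (hdisj : Disjoint S O) : (candidates S O col t m).Nonempty := by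
  obtain ⟨x, -, hx⟩ := hb.exists_distributed (sum_nst hD hm) (empty_subset S) (fun _ => 0) (by
    intro v _ a
    simp [cnt])
  exact ⟨_, glue_mem_candidates hdisj hx⟩

/-- The condition `m < p` makes `t` the least integer with `D ≤ p * t`. -/
theorem le_card_of_mem_admissible (hb : Balanced S col D) (hpd : p * d = p ^ l * D)
    (hD : D + m = p * t) (hmp : m < p) {z : Vec p} (hz : z ∈ admissible S col d) :
    t ≤ #(z.support \ S) := by
  have h := (mem_admissible_iff.1 hz).lt_add hb hpd
  by_contra hc
  push Not at hc
  have : p * (#(z.support \ S) + 1) ≤ p * t := Nat.mul_le_mul_left _ hc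
  rw [mul_add, mul_one] at this
  omega

/-- Having at least `t` nonzero entries outside `S`, all within a set of size `t`, leaves no zero
entry there. -/
theorem outside_of_mem_admissible (hb : Balanced S col D) (hpd : p * d = p ^ l * D)
    (hD : D + m = p * t) (hmp : m < p) (hO : #O = t) {z : Vec p} (hz : z ∈ admissible S col d)
    (h : ∀ i, i ∉ S → z i ≠ 0 → i ∈ O) : (∀ i ∈ O, z i ≠ 0) ∧ Avoids S col d t z := by
  have h1 := le_card_of_mem_admissible hb hpd hD hmp hz
  have h2 : z.support \ S ⊆ O := by
    intro i hi
    rw [mem_sdiff, Finsupp.mem_support_iff] at hi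
    exact h i hi.2 hi.1
  have h3 : z.support \ S = O := eq_of_subset_of_card_le h2 (by omega)
  constructor
  · intro i hi
    rw [← h3, mem_sdiff, Finsupp.mem_support_iff] at hi
    exact hi.1
  · have := mem_admissible_iff.1 hz
    rwa [h3, hO] at this

theorem key_injective (hne : ξ ≠ η) {x y : ℕ → ZMod p} (h : ∀ i, key c ξ η x i = key c ξ η y i) :
    x = y := by
  have h1 : ∀ i, i ≠ η → x i = y i := by
    intro i hi
    have := h i
    rwa [key_of_ne _ _ hi, key_of_ne _ _ hi] at this
  funext i
  by_cases hi : i = η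
  · subst hi
    have := h i
    rw [key_self, key_self, h1 ξ hne] at this
    exact sub_left_injective this
  · exact h1 i hi

theorem key_eq_zero {x : ℕ → ZMod p} {n i : ℕ} (hx : ∀ j, n ≤ j → x j = 0) (hi : n ≤ i)
    (h : i = η → n ≤ ξ) : key c ξ η x i = 0 := by
  unfold key
  split_ifs with hc
  · rw [hx η (hc ▸ hi), hx ξ (h hc)]
    ring
  · exact hx i hi

theorem KeyLT.total (hne : ξ ≠ η) {x y : Vec p} (h : x ≠ y) :
    KeyLT c ξ η x y ∨ KeyLT c ξ η y x := by
  set T : Finset ℕ := {i ∈ insert η (x.support ∪ y.support) | key c ξ η x i ≠ key c ξ η y i} with hT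
  have hmem : ∀ i, i ∉ T → key c ξ η x i = key c ξ η y i := by
    intro i hi
    by_contra hc
    apply hi
    rw [hT, mem_filter]
    refine ⟨?_, hc⟩
    by_contra hi'
    simp only [mem_insert, mem_union, Finsupp.mem_support_iff, not_or, not_not] at hi'
    rw [key_of_ne _ _ hi'.1, key_of_ne _ _ hi'.1, hi'.2.1, hi'.2.2] at hc
    exact hc rfl
  have hTne : T.Nonempty := by
    by_contra hc
    rw [not_nonempty_iff_eq_empty] at hc
    exact h (DFunLike.coe_injective (key_injective hne fun i => hmem i (by simp [hc])))
  have h1 := (mem_filter.1 (max'_mem T hTne)).2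
  have h2 : ∀ i, T.max' hTne < i → key c ξ η x i = key c ξ η y i := fun i hi =>
    hmem i fun hc => absurd (le_max' T i hc) (not_le.2 hi)
  rcases lt_trichotomy (key c ξ η x (T.max' hTne)).val (key c ξ η y (T.max' hTne)).val with
    h3 | h3 | h3
  · exact Or.inl ⟨_, h3, h2⟩
  · exact absurd (ZMod.val_injective p h3) h1
  · exact Or.inr ⟨_, h3, fun i hi => (h2 i hi).symm⟩

theorem eq_zero_of_val_lt_one {a : ZMod p} (h : a.val < (1 : ZMod p).val) : a = 0 := by
  rw [ZMod.val_one] at h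
  exact (ZMod.val_eq_zero a).1 (by omega)

theorem not_val_lt_zero (a : ZMod p) : ¬ a.val < (0 : ZMod p).val := by simp

/-- The indices excluded from the layering of the blocks. -/
def exceptional (ξ η : ℕ) : Finset ℕ := if η < ξ then {η} else {ξ, η}

/-- The possible supports of the codes in the course of the construction. -/
def Shape (ξ η : ℕ) (S : Finset ℕ) (col : ℕ → Fin l → ZMod p) : Prop :=
  ((η < ξ ∨ (ξ ∉ S ∧ η ∉ S)) ∧ ∃ n, ∀ i, i ∈ S ↔ i < n) ∨
  (ξ < η ∧ ξ ∈ S ∧ η ∈ S ∧ col ξ = col η ∧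
    (∀ i i', i < i' → i' ∈ S → i' ≠ ξ → i' ≠ η → i ∈ S) ∧
    ∀ i i', i < ξ → i' < ξ → i ∉ S → i' ∉ S → i = i')

/-- The column of height `l + 1` obtained by appending the entry of `z`. -/
def snocCol (col : ℕ → Fin l → ZMod p) (z : ℕ → ZMod p) (i : ℕ) : Fin (l + 1) → ZMod p :=
  Fin.snoc (α := fun _ => ZMod p) (col i) (z i)

/-- `z` is the least candidate for the set `O` of new indices, which lie above the old ones. -/
structure IsStep (c : ZMod p) (ξ η : ℕ) (S O : Finset ℕ) (col : ℕ → Fin l → ZMod p) (t m : ℕ)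
    (z : Vec p) : Prop where
  card : #O = t
  disj : Disjoint S O
  mem : z ∈ candidates S O col t m
  min : ∀ x ∈ candidates S O col t m, ¬ KeyLT c ξ η x z
  above : ∀ i ∈ S, i ∉ exceptional ξ η → ∀ i' ∈ O, i' ∉ exceptional ξ η → i < i'
  shape : Shape ξ η (S ∪ O) (snocCol col z)

/-- An admissible sequence which precedes no candidate is the least candidate. -/
theorem exists_min_candidate (hne : ξ ≠ η) (hwf : WellFounded fun x y : Vec p => KeyLT c ξ η x y)
    (hb : Balanced S col D) (hpd : p * d = p ^ l * D)
    (hD : D + m = p * t) (hm : m ≤ t) (hO : #O = t) (hdisj : Disjoint S O) {z : Vec p}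
    (hzmin : ∀ x ∈ admissible S col d, ¬ KeyLT c ξ η x z)
    (hcontra : ∀ zs ∈ candidates S O col t m,
      (∀ x ∈ candidates S O col t m, ¬ KeyLT c ξ η x zs) → ¬ KeyLT c ξ η z zs) :
    z ∈ candidates S O col t m ∧ ∀ x ∈ candidates S O col t m, ¬ KeyLT c ξ η x z := by
  have hne' := candidates_nonempty (O := O) hb hD hm hdisj
  set zs := hwf.min _ hne' with hzs
  have h1 : zs ∈ candidates S O col t m := hwf.min_mem _ hne'
  have h2 : ∀ x ∈ candidates S O col t m, ¬ KeyLT c ξ η x zs := fun x hx =>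
    hwf.not_lt_min _ hx
  have h3 : z = zs := by
    by_contra hc
    rcases KeyLT.total (c := c) hne hc with h | h
    · exact hcontra zs h1 h2 h
    · exact hzmin zs (candidates_subset_admissible hb hpd hD hm hO hdisj h1) h
  rw [h3]
  exact ⟨h1, h2⟩

theorem key_eq_of_lt (h : η < ξ) {x y : ℕ → ZMod p} {N : ℕ} (hxy : ∀ i, N < i → x i = y i) (i : ℕ)
    (hi : N < i) : key c ξ η x i = key c ξ η y i := by
  by_cases hiη : i = η
  · subst hiη
    rw [key_self, key_self, hxy i hi, hxy ξ (hi.trans h)]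
  · rw [key_of_ne _ _ hiη, key_of_ne _ _ hiη, hxy i hi]

theorem eq_of_key_eq (h : η < ξ) {x y : ℕ → ZMod p} {N : ℕ}
    (hxy : ∀ i, N < i → key c ξ η x i = key c ξ η y i) (i : ℕ) (hi : N < i) : x i = y i := by
  have h1 : ∀ i, N < i → i ≠ η → x i = y i := by
    intro i hi hiη
    have := hxy i hi
    rwa [key_of_ne _ _ hiη, key_of_ne _ _ hiη] at this
  by_cases hiη : i = η
  · subst hiη
    have := hxy i hi
    rw [key_self, key_self, h1 ξ (hi.trans h) h.ne'] at this
    exact sub_left_injective this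
  · exact h1 i hi hiη

/-- The entry at `ξ` is fixed before `η` is compared, so the word is determined from the top as for
the standard basis: the next `t` positions are filled with the least nonzero residue. -/
theorem isStep_of_lt (hc : c = 0 ∨ c = 1) (hηξ : η < ξ)
    (hwf : WellFounded fun x y : Vec p => KeyLT c ξ η x y)
    (hb : Balanced S col D) (hpd : p * d = p ^ l * D) (hD : D + m = p * t) (hm : m + 2 ≤ t)
    (hmp : m < p) (hL : Layered (exceptional ξ η) S col) {n : ℕ} (hS : ∀ i, i ∈ S ↔ i < n)
    {z : Vec p} (hz : z ∈ admissible S col d)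
    (hzmin : ∀ x ∈ admissible S col d, ¬ KeyLT c ξ η x z) :
    ∃ O, IsStep c ξ η S O col t m z := by
  have hO : #(Ico n (n + t)) = t := by simp
  have hdisj : Disjoint S (Ico n (n + t)) := by
    rw [disjoint_left]
    intro i hi hi'
    rw [hS] at hi
    rw [mem_Ico] at hi'
    omega
  rw [exceptional, if_pos hηξ] at hL
  obtain ⟨h1, h2⟩ := exists_min_candidate hηξ.ne' hwf hb hpd hD (by omega) hO hdisj hzmin (by
    rintro zs hzs hzsmin ⟨N, hlt, hag⟩
    have hag' := eq_of_key_eq hηξ hag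
    have hzs0 : ∀ i, n + t ≤ i → zs i = 0 := fun i hi =>
      hzs.2.1 i (by rw [hS]; omega) (by rw [mem_Ico]; omega)
    have hzs1 : ∀ i, n ≤ i → i < n + t → zs i = 1 := fun i h1 h2 => hzs.1 i (by rw [mem_Ico]; omega)
    have hNlt : N < n + t := by
      by_contra hge
      push Not at hge
      rw [key_eq_zero (x := zs) hzs0 hge (by omega)] at hlt
      exact not_val_lt_zero _ hlt
    obtain ⟨hnz, hav⟩ := outside_of_mem_admissible hb hpd hD hmp hO hz (by
      intro i hi hzi
      rw [hS] at hi
      rw [mem_Ico]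
      refine ⟨by omega, ?_⟩
      by_contra hge
      exact hzi ((hag' i (by omega)).trans (hzs0 i (by omega))))
    by_cases hNn : n ≤ N
    · have hzN := hnz N (by rw [mem_Ico]; omega)
      have hzsN := hzs1 N hNn hNlt
      by_cases hNη : N = η
      · subst hNη
        rw [key_self, key_self, hag' ξ hηξ, hzsN] at hlt
        -- The shift at a new position `η` is 0 or 1. With shift 1 the entry 1 already has key zero;
        -- with shift 0 a smaller key would force a zero entry.
        have hzero : c * zs ξ = 0 ∨ c * zs ξ = 1 := by
          rcases hc with rfl | rfl
          · simp
          · by_cases hξ : ξ < n + t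
            · rw [hzs1 ξ (by omega) hξ]
              simp
            · rw [hzs0 ξ (by omega)]
              simp
        rcases hzero with h0 | h0
        · rw [h0, sub_zero, sub_zero] at hlt
          exact hzN (eq_zero_of_val_lt_one hlt)
        · rw [h0, sub_self] at hlt
          exact not_val_lt_zero _ hlt
      · rw [key_of_ne _ _ hNη, key_of_ne _ _ hNη, hzsN] at hlt
        exact hzN (eq_zero_of_val_lt_one hlt)
    · have hkey : ∀ (x : ℕ → ZMod p) (M : ℕ), (∀ i, M < i → x i = zs i) →
          key c ξ η x M = x M - if M = η then c * zs ξ else 0 := by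
        intro x M hx
        by_cases hM : M = η
        · subst hM
          rw [key_self, if_pos rfl, hx ξ hηξ]
        · rw [key_of_ne _ _ hM, if_neg hM, sub_zero]
      rw [hkey z N hag', hkey zs N fun _ _ => rfl] at hlt
      refine hav.not_lt_of_shift hb hpd hD hm hL hzs.2.2 ?_ (by rw [hS]; omega)
        (fun i _ hi => hag' i hi) hlt
      intro x hx M hM hxM hlt'
      have hgl : ∀ i, M < i → glue S (Ico n (n + t)) x i = zs i := by
        intro i hi
        by_cases hiS : i ∈ S
        · rw [glue_of_mem _ _ hiS, hxM i hiS hi]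
        · exact glue_eq_of_notMem hzs x hiS
      refine hzsmin _ (glue_mem_candidates hdisj hx) ⟨M, ?_, key_eq_of_lt hηξ hgl⟩
      rw [hkey _ M hgl, hkey zs M fun _ _ => rfl, glue_of_mem _ _ hM]
      exact hlt')
  refine ⟨_, hO, hdisj, h1, h2, ?_, Or.inl ⟨Or.inl hηξ, n + t, fun i => ?_⟩⟩
  · intro i hi _ i' hi' _
    rw [hS] at hi
    rw [mem_Ico] at hi'
    omega
  · rw [mem_union, hS, mem_Ico]
    omega

theorem not_keyLT_of_notMem (hb : Balanced S col D) (hpd : p * d = p ^ l * D)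
    (hD : D + m = p * t) (hm : m + 2 ≤ t) (hL : Layered {ξ, η} S col)
    (hξ : ξ ∉ S) (hη : η ∉ S) (hdisj : Disjoint S O) {z zs : Vec p}
    (hzs : zs ∈ candidates S O col t m)
    (hzsmin : ∀ x ∈ candidates S O col t m, ¬ KeyLT c ξ η x zs) (hav : Avoids S col d t z) {N : ℕ}
    (hN : N ∈ S) (hag : ∀ i, N < i → key c ξ η z i = key c ξ η zs i) :
    ¬ (key c ξ η z N).val < (key c ξ η zs N).val := by
  intro hlt
  have hneη : ∀ i ∈ S, i ≠ η := by
    rintro i hi rfl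
    exact hη hi
  have hneξ : ∀ i ∈ S, i ≠ ξ := by
    rintro i hi rfl
    exact hξ hi
  have hL' : Layered {η} S col := by
    intro i hi _ i' hi' _
    exact hL i hi (by simp [hneη i hi, hneξ i hi]) i' hi' (by simp [hneη i' hi', hneξ i' hi'])
  refine hav.not_lt_of_shift (φ := 0) hb hpd hD hm hL' hzs.2.2 ?_ hN ?_ ?_
  · intro x hx M hM hxM hlt'
    rw [ite_self, sub_zero, sub_zero] at hlt'
    refine hzsmin _ (glue_mem_candidates hdisj hx) ⟨M, ?_, fun i hi => ?_⟩
    · rw [key_of_ne _ _ (hneη M hM), key_of_ne _ _ (hneη M hM), glue_of_mem _ _ hM]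
      exact hlt'
    · by_cases hiS : i ∈ S
      · rw [key_of_ne _ _ (hneη i hiS), key_of_ne _ _ (hneη i hiS), glue_of_mem _ _ hiS,
          hxM i hiS hi]
      · unfold key
        rw [glue_eq_of_notMem hzs x hiS, glue_eq_of_notMem hzs x hξ, glue_eq_of_notMem hzs x hη]
  · intro i hi hNi
    have := hag i hNi
    rwa [key_of_ne _ _ (hneη i hi), key_of_ne _ _ (hneη i hi)] at this
  · rw [ite_self, sub_zero, sub_zero]
    rwa [key_of_ne _ _ (hneη N hN), key_of_ne _ _ (hneη N hN)] at hlt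

/-- Entries 1 at both `ξ` and `η` cost nothing at `η`. Thus if the next `t` positions contain `ξ`
but not `η`, placing an entry at `η` frees a lower position. The cases differ in where `ξ` and `η`
lie relative to those positions. -/
theorem isStep_of_notMem (hξη : ξ < η)
    (hwf : WellFounded fun x y : Vec p => KeyLT 1 ξ η x y)
    (hb : Balanced S col D) (hpd : p * d = p ^ l * D) (hD : D + m = p * t) (hm : m + 2 ≤ t)
    (hmp : m < p) (hL : Layered (exceptional ξ η) S col) (hSc : ∀ i, i ∈ S ↔ col i ≠ 0)
    {n : ℕ} (hS : ∀ i, i ∈ S ↔ i < n) (hξ : ξ ∉ S) (hη : η ∉ S) {z : Vec p}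
    (hz : z ∈ admissible S col d)
    (hzmin : ∀ x ∈ admissible S col d, ¬ KeyLT 1 ξ η x z) :
    ∃ O, IsStep 1 ξ η S O col t m z := by
  rw [exceptional, if_neg (by omega)] at hL
  have hnξ : n ≤ ξ := by
    rw [hS] at hξ
    omega
  have hcol : col ξ = col η := by
    rw [hSc, not_not] at hξ hη
    rw [hξ, hη]
  -- it suffices to find the new indices
  have hmain : ∀ O : Finset ℕ, #O = t → (∀ i ∈ O, n ≤ i) →
      (∀ zs ∈ candidates S O col t m, ∀ N, (key 1 ξ η z N).val < (key 1 ξ η zs N).val →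
        (∀ i, N < i → key 1 ξ η z i = key 1 ξ η zs i) →
        (∀ i, i ∉ S → z i ≠ 0 → i ∈ O) ∧
          (n ≤ N → key 1 ξ η zs N = 0 ∨ N ∈ O ∧ key 1 ξ η zs N = 1 ∧ N ≠ η)) →
      ((ξ ∈ O → z ξ = 1) → (η ∈ O → z η = 1) → Shape ξ η (S ∪ O) (snocCol col z)) →
      ∃ O, IsStep 1 ξ η S O col t m z := by
    intro O hO hOn hsupp hshape
    have hdisj : Disjoint S O := by
      rw [disjoint_left]
      intro i hi hi'
      rw [hS] at hi
      have := hOn i hi'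
      omega
    obtain ⟨h1, h2⟩ := exists_min_candidate hξη.ne hwf hb hpd hD (by omega) hO hdisj hzmin (by
      rintro zs hzs hzsmin ⟨N, hlt, hag⟩
      obtain ⟨hsup, hNn⟩ := hsupp zs hzs N hlt hag
      obtain ⟨hnz, hav⟩ := outside_of_mem_admissible hb hpd hD hmp hO hz hsup
      by_cases hN : N ∈ S
      · exact not_keyLT_of_notMem hb hpd hD hm hL hξ hη hdisj hzs hzsmin hav hN hag hlt
      · rw [hS] at hN
        rcases hNn (by omega) with h0 | ⟨hNO, h1, hNη⟩
        · rw [h0] at hlt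
          exact not_val_lt_zero _ hlt
        · rw [h1, key_of_ne _ _ hNη] at hlt
          exact hnz N hNO (eq_zero_of_val_lt_one hlt))
    refine ⟨O, hO, hdisj, h1, h2, ?_, hshape (h1.1 ξ) (h1.1 η)⟩
    intro i hi _ i' hi' _
    rw [hS] at hi
    have := hOn i' hi'
    omega
  have hvan : ∀ zs : Vec p, ∀ N, (∀ i, N < i → key 1 ξ η z i = key 1 ξ η zs i) →
      ∀ i, N < i → i ≠ η → zs i = 0 → z i = 0 := by
    intro zs N hag i hi hiη hzi
    have := hag i hi
    rwa [key_of_ne _ _ hiη, key_of_ne _ _ hiη, hzi] at this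
  have hcol' : z ξ = 1 → z η = 1 → snocCol col z ξ = snocCol col z η := by
    intro h1 h2
    rw [snocCol, snocCol, hcol, h1, h2]
  by_cases hηn : η < n + t
  · refine hmain (Ico n (n + t)) (by simp) (fun i hi => (mem_Ico.1 hi).1) ?_ ?_
    · rintro zs ⟨hzs1, hzs0, -⟩ N hlt hag
      have hzs0' : ∀ i, n + t ≤ i → zs i = 0 := fun i hi =>
        hzs0 i (by rw [hS]; omega) (by rw [mem_Ico]; omega)
      have hNlt : N < n + t := by
        by_contra hge
        rw [key_of_ne _ (zs : ℕ → ZMod p) (by omega), hzs0' N (by omega)] at hlt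
        exact not_val_lt_zero _ hlt
      refine ⟨fun i hi hzi => ?_, fun hN => ?_⟩
      · rw [hS] at hi
        rw [mem_Ico]
        refine ⟨by omega, ?_⟩
        by_contra hge
        exact hzi (hvan zs N hag i (by omega) (by omega) (hzs0' i (by omega)))
      · by_cases hNη : N = η
        · left
          rw [hNη, key_self, hzs1 η (by rw [mem_Ico]; omega), hzs1 ξ (by rw [mem_Ico]; omega)]
          ring
        · right
          have hmem : N ∈ Ico n (n + t) := by rw [mem_Ico]; omega
          exact ⟨hmem, by rw [key_of_ne _ _ hNη, hzs1 N hmem], hNη⟩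
    · intro h1 h2
      have hmem : ∀ i, i ∈ S ∪ Ico n (n + t) ↔ i < n + t := by
        intro i
        rw [mem_union, hS, mem_Ico]
        omega
      right
      simp only [hmem]
      refine ⟨hξη, by omega, hηn, hcol' (h1 (by rw [mem_Ico]; omega)) (h2 (by rw [mem_Ico]; omega)),
        by omega, by omega⟩
  by_cases hξn : n + t ≤ ξ
  · refine hmain (Ico n (n + t)) (by simp) (fun i hi => (mem_Ico.1 hi).1) ?_ ?_
    · rintro zs ⟨hzs1, hzs0, -⟩ N hlt hag
      have hzs0' : ∀ i, n + t ≤ i → zs i = 0 := fun i hi =>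
        hzs0 i (by rw [hS]; omega) (by rw [mem_Ico]; omega)
      have hNlt : N < n + t := by
        by_contra hge
        rw [key_eq_zero (x := zs) hzs0' (by omega) (by omega)] at hlt
        exact not_val_lt_zero _ hlt
      refine ⟨fun i hi hzi => ?_, fun hN => ?_⟩
      · rw [hS] at hi
        rw [mem_Ico]
        refine ⟨by omega, ?_⟩
        by_contra hge
        by_cases hiη : i = η
        · subst hiη
          have h3 := hag i (by omega)
          rw [key_self, key_self, hzs0' i (by omega), hzs0' ξ hξn,
            hvan zs N hag ξ (by omega) hξη.ne (hzs0' ξ hξn), mul_zero, sub_zero, sub_zero] at h3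
          exact hzi h3
        · exact hzi (hvan zs N hag i (by omega) hiη (hzs0' i (by omega)))
      · right
        have hmem : N ∈ Ico n (n + t) := by rw [mem_Ico]; omega
        exact ⟨hmem, by rw [key_of_ne _ _ (by omega), hzs1 N hmem], by omega⟩
    · intro _ _
      have hmem : ∀ i, i ∈ S ∪ Ico n (n + t) ↔ i < n + t := by
        intro i
        rw [mem_union, hS, mem_Ico]
        omega
      left
      simp only [hmem]
      exact ⟨Or.inr ⟨by omega, by omega⟩, n + t, fun i => Iff.rfl⟩
  by_cases hξt : ξ < n + t - 1
  · refine hmain (insert η (Ico n (n + t - 1))) ?_ ?_ ?_ ?_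
    · rw [card_insert_of_notMem (by rw [mem_Ico]; omega), Nat.card_Ico]
      omega
    · intro i hi
      rw [mem_insert, mem_Ico] at hi
      omega
    · rintro zs ⟨hzs1, hzs0, -⟩ N hlt hag
      have hzs0' : ∀ i, n + t - 1 ≤ i → i ≠ η → zs i = 0 := fun i hi hiη =>
        hzs0 i (by rw [hS]; omega) (by rw [mem_insert, mem_Ico]; omega)
      have hNlt : N < n + t - 1 := by
        by_contra hge
        by_cases hNη : N = η
        · rw [hNη, key_self _ _ _ (zs : ℕ → ZMod p), hzs1 η (by simp), hzs1 ξ (by rw [mem_insert, mem_Ico]; omega),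
            one_mul, sub_self] at hlt
          exact not_val_lt_zero _ hlt
        · rw [key_of_ne _ (zs : ℕ → ZMod p) hNη, hzs0' N (by omega) hNη] at hlt
          exact not_val_lt_zero _ hlt
      refine ⟨fun i hi hzi => ?_, fun hN => ?_⟩
      · rw [hS] at hi
        rw [mem_insert, mem_Ico]
        by_contra hge
        exact hzi (hvan zs N hag i (by omega) (by omega) (hzs0' i (by omega) (by omega)))
      · right
        have hmem : N ∈ insert η (Ico n (n + t - 1)) := by rw [mem_insert, mem_Ico]; omega
        exact ⟨hmem, by rw [key_of_ne _ _ (by omega), hzs1 N hmem], by omega⟩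
    · intro h1 h2
      have hmem : ∀ i, i ∈ S ∪ insert η (Ico n (n + t - 1)) ↔ (i < n + t - 1 ∨ i = η) := by
        intro i
        rw [mem_union, hS, mem_insert, mem_Ico]
        omega
      refine Or.inr ⟨hξη, (hmem _).2 (by omega), (hmem _).2 (by omega),
        hcol' (h1 (by rw [mem_insert, mem_Ico]; omega)) (h2 (by simp)), ?_, ?_⟩
      · simp only [hmem]
        omega
      · simp only [hmem]
        omega
  · have hξe : ξ = n + t - 1 := by omega
    have hmemO : ∀ i, i ∈ insert η (insert ξ (Ico n (n + t - 2))) ↔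
        i = η ∨ i = ξ ∨ (n ≤ i ∧ i < n + t - 2) := by
      intro i
      rw [mem_insert, mem_insert, mem_Ico]
    -- Here `ξ` is the last of the `t` positions. It cannot be dropped, so `η` replaces the position
    -- just below it, which creates the one gap below `ξ` allowed by `Shape`.
    refine hmain (insert η (insert ξ (Ico n (n + t - 2)))) ?_ ?_ ?_ ?_
    · rw [card_insert_of_notMem (by rw [mem_insert, mem_Ico]; omega),
        card_insert_of_notMem (by rw [mem_Ico]; omega), Nat.card_Ico]
      omega
    · intro i hi
      rw [hmemO] at hi
      omega
    · rintro zs ⟨hzs1, hzs0, -⟩ N hlt hag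
      simp only [hmemO] at hzs1 hzs0
      have hzs0' : ∀ i, n + t - 2 ≤ i → i ≠ η → i ≠ ξ → zs i = 0 := fun i hi hiη hiξ =>
        hzs0 i (by rw [hS]; omega) (by omega)
      have hkeyη : key 1 ξ η zs η = 0 := by
        rw [key_self, hzs1 η (by simp), hzs1 ξ (by simp)]
        ring
      have hNη : N ≠ η := by
        rintro rfl
        rw [hkeyη] at hlt
        exact not_val_lt_zero _ hlt
      have hNlt : N ≤ ξ := by
        by_contra hge
        rw [key_of_ne _ (zs : ℕ → ZMod p) hNη, hzs0' N (by omega) hNη (by omega)] at hlt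
        exact not_val_lt_zero _ hlt
      have hNξ : N ≠ ξ := by
        rintro rfl
        rw [key_of_ne _ _ hNη, key_of_ne _ _ hNη, hzs1 N (by simp)] at hlt
        -- A zero at `ξ` forces a zero at `η` and leaves only `t - 1` positions outside `S`, fewer
        -- than the required `t`.
        have hzN := eq_zero_of_val_lt_one hlt
        have hzη : z η = 0 := by
          have := hag η hξη
          rwa [hkeyη, key_self, hzN, mul_zero, sub_zero] at this
        have h1 := le_card_of_mem_admissible hb hpd hD hmp hz
        have h2 : z.support \ S ⊆ Ico n (n + t - 1) := by
          intro i hi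
          rw [mem_sdiff, Finsupp.mem_support_iff, hS] at hi
          rw [mem_Ico]
          refine ⟨by omega, ?_⟩
          by_contra hge
          by_cases hiN : i = N
          · exact hi.1 (hiN ▸ hzN)
          by_cases hiη : i = η
          · exact hi.1 (hiη ▸ hzη)
          exact hi.1 (hvan zs N hag i (by omega) hiη (hzs0' i (by omega) hiη hiN))
        have h3 := card_le_card h2
        rw [Nat.card_Ico] at h3
        omega
      have hNt : N < n + t - 2 := by
        by_contra hge
        rw [key_of_ne _ (zs : ℕ → ZMod p) hNη, hzs0' N (by omega) hNη hNξ] at hlt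
        exact not_val_lt_zero _ hlt
      refine ⟨fun i hi hzi => ?_, fun hN => ?_⟩
      · rw [hS] at hi
        rw [hmemO]
        by_contra hge
        exact hzi (hvan zs N hag i (by omega) (by omega) (hzs0' i (by omega) (by omega) (by omega)))
      · right
        rw [hmemO]
        exact ⟨by omega, by rw [key_of_ne _ _ hNη, hzs1 N (by omega)], hNη⟩
    · intro h1 h2
      have hmem : ∀ i, i ∈ S ∪ insert η (insert ξ (Ico n (n + t - 2))) ↔
          (i < n + t - 2 ∨ i = η ∨ i = ξ) := by
        intro i
        rw [mem_union, hS, hmemO]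
        omega
      refine Or.inr ⟨hξη, (hmem _).2 (by omega), (hmem _).2 (by omega),
        hcol' (h1 (by simp)) (h2 (by simp)), ?_, ?_⟩
      · simp only [hmem]
        omega
      · simp only [hmem]
        omega

theorem exists_initial_notMem (S : Finset ℕ) (t : ℕ) :
    ∃ O : Finset ℕ, #O = t ∧ Disjoint S O ∧ ∀ i, i ∉ S → i ∉ O → ∀ o ∈ O, o < i := by
  induction t with
  | zero => exact ⟨∅, by simp⟩
  | succ t ih =>
    obtain ⟨O, hO, hdisj, hlt⟩ := ih
    have hex : ∃ i, i ∉ S ∪ O := Infinite.exists_notMem_finset _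
    have hfind := Nat.find_spec hex
    have hmin : ∀ i, i ∉ S ∪ O → Nat.find hex ≤ i := fun i hi => Nat.find_min' hex hi
    rw [notMem_union] at hfind
    refine ⟨insert (Nat.find hex) O, ?_, ?_, ?_⟩
    · rw [card_insert_of_notMem hfind.2, hO]
    · rw [disjoint_insert_right]
      exact ⟨hfind.1, hdisj⟩
    · intro i hiS hiO o ho
      rw [mem_insert, not_or] at hiO
      rw [mem_insert] at ho
      have h1 := hmin i (by rw [notMem_union]; exact ⟨hiS, hiO.2⟩)
      rcases ho with rfl | ho
      · omega
      · exact hlt i hiS hiO.2 o ho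

/-- With `ξ` and `η` already in the support the key of the least candidate at `η` is zero, and the
new positions are the lowest free ones. -/
theorem isStep_of_mem (hξη : ξ < η)
    (hwf : WellFounded fun x y : Vec p => KeyLT 1 ξ η x y)
    (hb : Balanced S col D) (hpd : p * d = p ^ l * D) (hD : D + m = p * t) (hm : m + 2 ≤ t)
    (hmp : m < p) (hL : Layered (exceptional ξ η) S col) (hξ : ξ ∈ S) (hη : η ∈ S)
    (hcol : col ξ = col η) (hdown : ∀ i i', i < i' → i' ∈ S → i' ≠ ξ → i' ≠ η → i ∈ S)
    (hgap : ∀ i i', i < ξ → i' < ξ → i ∉ S → i' ∉ S → i = i') {z : Vec p}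
    (hz : z ∈ admissible S col d)
    (hzmin : ∀ x ∈ admissible S col d, ¬ KeyLT 1 ξ η x z) :
    ∃ O, IsStep 1 ξ η S O col t m z := by
  have hex : exceptional ξ η = {ξ, η} := if_neg (by omega)
  rw [hex] at hL
  obtain ⟨O, hO, hdisj, hOlt⟩ := exists_initial_notMem S t
  have hOS : ∀ o ∈ O, o ∉ S := fun o ho => disjoint_right.1 hdisj ho
  have hfun : ∀ zs ∈ candidates S O col t m,
      (∀ x ∈ candidates S O col t m, ¬ KeyLT 1 ξ η x zs) →
      ∀ x, Distributed S col (nst t m) x → ∀ N ∈ S,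
      (∀ i ∈ S, N < i → key 1 ξ η x i = key 1 ξ η zs i) →
      ¬ (key 1 ξ η x N).val < (key 1 ξ η zs N).val := by
    intro zs hzs hzsmin x hx N hN hag hlt
    have hk : ∀ i ∈ S, key 1 ξ η (glue S O x) i = key 1 ξ η x i := by
      intro i hi
      unfold key
      rw [glue_of_mem _ _ hi, glue_of_mem _ _ hξ, glue_of_mem _ _ hη]
    refine hzsmin _ (glue_mem_candidates hdisj hx) ⟨N, by rwa [hk N hN], fun i hi => ?_⟩
    by_cases hiS : i ∈ S
    · rw [hk i hiS, hag i hiS hi]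
    · have hiη : i ≠ η := by
        rintro rfl
        exact hiS hη
      rw [key_of_ne _ _ hiη, key_of_ne _ _ hiη, glue_eq_of_notMem hzs x hiS]
  obtain ⟨h1, h2⟩ := exists_min_candidate hξη.ne hwf hb hpd hD (by omega) hO hdisj hzmin (by
    rintro zs hzs hzsmin ⟨N, hlt, hag⟩
    have hmin := hfun zs hzs hzsmin
    have heq := hzs.2.2.eq_of_coupled hb hD hm hξη hξ hη hcol hmin
    have hNη : N ≠ η := by
      rintro rfl
      rw [key_self _ _ _ (zs : ℕ → ZMod p), heq, one_mul, sub_self] at hlt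
      exact not_val_lt_zero _ hlt
    have hvan : ∀ i, i ∉ S → i ∉ O → N < i → z i = 0 := by
      intro i hiS hiO hi
      have hiη : i ≠ η := by
        rintro rfl
        exact hiS hη
      have := hag i hi
      rwa [key_of_ne _ _ hiη, key_of_ne _ _ hiη, hzs.2.1 i hiS hiO] at this
    by_cases hN : N ∈ S
    · obtain ⟨-, hav⟩ := outside_of_mem_admissible hb hpd hD hmp hO hz (by
        intro i hiS hzi
        by_contra hiO
        have hle : i ≤ N := by
          by_contra hc
          exact hzi (hvan i hiS hiO (by omega))
        have hlt' : i < N := lt_of_le_of_ne hle (by rintro rfl; exact hiS hN)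
        -- A nonzero entry outside `S ∪ O` below `N` forces `N = ξ`, since otherwise `S` is closed
        -- downward from `N`. Then all of `O`, with at least two elements, would consist of gaps
        -- below `ξ`, but there is at most one.
        have hNξ : N = ξ := by
          by_contra hc
          exact hiS (hdown i N hlt' hN hc hNη)
        subst hNξ
        obtain ⟨a, ha, b, hb', hab⟩ := one_lt_card.1 (show 1 < #O by omega)
        have ha' := hOlt i hiS hiO a ha
        have hb'' := hOlt i hiS hiO b hb'
        exact hab (hgap a b (by omega) (by omega) (hOS a ha) (hOS b hb')))
      exact hav.not_lt_of_coupled hb hpd hD hm hξη hξ hη hcol hL hzs.2.2 hmin hN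
        (fun i _ hi => hag i hi) hlt
    · rw [key_of_ne _ _ hNη, key_of_ne _ _ hNη] at hlt
      by_cases hNO : N ∈ O
      · rw [hzs.1 N hNO] at hlt
        refine (outside_of_mem_admissible hb hpd hD hmp hO hz ?_).1 N hNO (eq_zero_of_val_lt_one hlt)
        intro i hiS hzi
        by_contra hiO
        exact hzi (hvan i hiS hiO (hOlt i hiS hiO N hNO))
      · rw [hzs.2.1 N hN hNO] at hlt
        exact not_val_lt_zero _ hlt)
  refine ⟨O, hO, hdisj, h1, h2, ?_, Or.inr ⟨hξη, mem_union_left _ hξ, mem_union_left _ hη, ?_, ?_, ?_⟩⟩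
  · intro i hi hiEx i' hi' _
    rw [hex, mem_insert, mem_singleton, not_or] at hiEx
    by_contra hc
    have hne : i' ≠ i := by
      rintro rfl
      exact hOS _ hi' hi
    exact hOS i' hi' (hdown i' i (by omega) hi hiEx.1 hiEx.2)
  · rw [snocCol, snocCol, hcol, h1.2.2.eq_of_coupled hb hD hm hξη hξ hη hcol (hfun z h1 h2)]
  · intro i i' hlt hi' h3 h4
    by_contra hc
    rw [notMem_union] at hc
    rcases mem_union.1 hi' with h | h
    · exact hc.1 (hdown i i' hlt h h3 h4)
    · exact absurd (hOlt i hc.1 hc.2 i' h) (by omega)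
  · intro i i' h3 h4 h5 h6
    rw [notMem_union] at h5 h6
    exact hgap i i' h3 h4 h5.1 h6.1

/-- The invariants of the greedy construction. -/
structure Invariant (ξ η : ℕ) (S : Finset ℕ) (col : ℕ → Fin l → ZMod p) (D : ℕ) : Prop where
  mem : ∀ i, i ∈ S ↔ col i ≠ 0
  balanced : Balanced S col D
  layered : Layered (exceptional ξ η) S col
  shape : Shape ξ η S col

theorem Invariant.exists_isStep (h : Invariant ξ η S col D)
    (hcase : η < ξ ∧ (c = 0 ∨ c = 1) ∨ ξ < η ∧ c = 1)
    (hwf : WellFounded fun x y : Vec p => KeyLT c ξ η x y)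
    (hpd : p * d = p ^ l * D) (hD : D + m = p * t) (hm : m + 2 ≤ t)
    (hmp : m < p) {z : Vec p} (hz : z ∈ admissible S col d)
    (hzmin : ∀ x ∈ admissible S col d, ¬ KeyLT c ξ η x z) :
    ∃ O, IsStep c ξ η S O col t m z := by
  rcases hcase with ⟨hlt, hc⟩ | ⟨hlt, rfl⟩
  · rcases h.shape with ⟨-, n, hn⟩ | ⟨h1, -⟩
    · exact isStep_of_lt hc hlt hwf h.balanced hpd hD hm hmp h.layered hn hz hzmin
    · omega
  · rcases h.shape with ⟨h1 | ⟨h1, h2⟩, n, hn⟩ | ⟨-, h1, h2, h3, h4, h5⟩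
    · omega
    · exact isStep_of_notMem hlt hwf h.balanced hpd hD hm hmp h.layered h.mem hn h1 h2 hz hzmin
    · exact isStep_of_mem hlt hwf h.balanced hpd hD hm hmp h.layered h1 h2 h3 h4 h5 hz hzmin

end Step

/-! ### Passing to columns of height one more -/

section Extension

variable {p : ℕ} [Fact p.Prime] {l : ℕ}
variable {S O : Finset ℕ} {col : ℕ → Fin l → ZMod p} {D d t m : ℕ} {c : ZMod p} {ξ η : ℕ}

theorem snoc_ne_zero_iff {v : Fin l → ZMod p} {a : ZMod p} :
    (Fin.snoc v a : Fin (l + 1) → ZMod p) ≠ 0 ↔ v ≠ 0 ∨ a ≠ 0 := by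
  rw [← not_iff_not, not_or, not_not, not_not, not_not]
  constructor
  · intro h
    refine ⟨funext fun j => ?_, ?_⟩
    · simpa using congrFun h j.castSucc
    · simpa using congrFun h (Fin.last l)
  · rintro ⟨rfl, rfl⟩
    funext j
    refine Fin.lastCases ?_ (fun j => ?_) j <;> simp

theorem isNormalized_snoc_iff {v : Fin l → ZMod p} {a : ZMod p} :
    IsNormalized (Fin.snoc v a : Fin (l + 1) → ZMod p) ↔ IsNormalized v ∨ v = 0 ∧ a = 1 := by
  constructor
  · rintro ⟨i, hi, hi'⟩
    induction i using Fin.lastCases with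
    | last =>
      right
      refine ⟨funext fun j => ?_, by simpa using hi⟩
      simpa using hi' j.castSucc (Fin.castSucc_lt_last j)
    | cast i =>
      left
      refine ⟨i, by simpa using hi, fun j hj => ?_⟩
      simpa using hi' j.castSucc (by simpa using hj)
  · rintro (⟨i, hi, hi'⟩ | ⟨rfl, rfl⟩)
    · refine ⟨i.castSucc, by simpa using hi, fun j hj => ?_⟩
      induction j using Fin.lastCases with
      | last => exact absurd hj (not_lt.2 (Fin.castSucc_lt_last i).le)
      | cast j => simpa using hi' j (by simpa using hj)
    · refine ⟨Fin.last l, by simp, fun j hj => ?_⟩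
      induction j using Fin.lastCases with
      | last => exact absurd hj (lt_irrefl _)
      | cast j => simp

theorem mem_union_iff_snocCol (hSc : ∀ i, i ∈ S ↔ col i ≠ 0) {z : Vec p}
    (hz : z ∈ candidates S O col t m) (i : ℕ) : i ∈ S ∪ O ↔ snocCol col z i ≠ 0 := by
  rw [snocCol, snoc_ne_zero_iff, ← hSc, mem_union]
  constructor
  · rintro (h | h)
    · exact Or.inl h
    · exact Or.inr (by simp [hz.1 i h])
  · rintro (h | h)
    · exact Or.inl h
    · by_contra hc
      push Not at hc
      exact h (hz.2.1 i hc.1 hc.2)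

theorem isNormalized_snocCol (hSc : ∀ i, i ∈ S ↔ col i ≠ 0) (hb : Balanced S col D) {z : Vec p}
    (hz : z ∈ candidates S O col t m) {i : ℕ} (hi : i ∈ S ∪ O) :
    IsNormalized (snocCol col z i) := by
  rw [snocCol, isNormalized_snoc_iff]
  by_cases hiS : i ∈ S
  · exact Or.inl (hb.norm i hiS)
  · right
    refine ⟨by simpa [hSc] using hiS, hz.1 i ?_⟩
    exact (mem_union.1 hi).resolve_left hiS

/-- The scarce value on the block of `v` is the one that makes the extended column have coordinate
sum zero. The new column `(0, …, 0, 1)` comes from `O` and has sum 1. -/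
theorem card_snocCol_eq (hSc : ∀ i, i ∈ S ↔ col i ≠ 0) (hO : #O = t) (hdisj : Disjoint S O)
    {z : Vec p} (hz : z ∈ candidates S O col t m) {u : Fin (l + 1) → ZMod p}
    (hu : IsNormalized u) :
    #{i ∈ S ∪ O | snocCol col z i = u} = if ∑ j, u j = 0 then t - m else t := by
  obtain ⟨v, a, rfl⟩ : ∃ v a, u = (Fin.snoc v a : Fin (l + 1) → ZMod p) :=
    ⟨Fin.init u, u (Fin.last l), (Fin.snoc_init_self u).symm⟩
  have heq : ∀ i, snocCol col z i = (Fin.snoc v a : Fin (l + 1) → ZMod p) ↔ col i = v ∧ z i = a := by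
    intro i
    rw [snocCol, Fin.snoc_inj]
  have hsum : ∑ j, (Fin.snoc v a : Fin (l + 1) → ZMod p) j = ∑ j, v j + a := by
    rw [Fin.sum_univ_castSucc]
    simp
  rw [filter_congr fun i _ => heq i, hsum]
  rcases isNormalized_snoc_iff.1 hu with hv | ⟨rfl, rfl⟩
  · have h1 := hz.2.2 v hv a
    have h2 : ((S ∪ O).filter fun i => col i = v ∧ z i = a) =
        S.filter fun i => col i = v ∧ z i = a := by
      rw [filter_union, filter_false_of_mem (s := O), union_empty]
      rintro i hi ⟨hiv, -⟩
      exact disjoint_right.1 hdisj hi ((hSc i).2 (hiv ▸ hv.ne_zero))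
    unfold cnt at h1
    rw [h2, h1, nst]
    refine if_congr ?_ rfl rfl
    rw [eq_neg_iff_add_eq_zero, add_comm]
  · rw [if_neg (by simp), filter_union, filter_false_of_mem (s := S), empty_union,
      filter_true_of_mem, hO]
    · intro i hi
      have hiS := disjoint_right.1 hdisj hi
      exact ⟨by simpa [hSc] using hiS, hz.1 i hi⟩
    · rintro i hi ⟨h0, -⟩
      exact (hSc i).1 hi h0

/-- Swapping the two positions would improve `z`. Excluding the exceptional indices ensures that the
swap does not alter a key at `η` above `i`. -/
theorem IsStep.not_val_lt {z : Vec p} (h : IsStep c ξ η S O col t m z) {i j : ℕ} (hi : i ∈ S)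
    (hj : j ∈ S) (hiEx : i ∉ exceptional ξ η) (hjEx : j ∉ exceptional ξ η) (hij : col i = col j)
    (hlt : j < i) : ¬ (z j).val < (z i).val := by
  intro hval
  have hiη : i ≠ η := by
    rintro rfl
    apply hiEx
    unfold exceptional
    split_ifs <;> simp
  have hjη : j ≠ η := by
    rintro rfl
    apply hjEx
    unfold exceptional
    split_ifs <;> simp
  have hgl : ∀ b, glue S O (fun b => z (Equiv.swap i j b)) b = z (Equiv.swap i j b) := by
    intro b
    by_cases hb : b ∈ S
    · exact glue_of_mem _ _ hb
    · rw [glue_eq_of_notMem h.mem _ hb, Equiv.swap_apply_of_ne_of_ne]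
      · rintro rfl
        exact hb hi
      · rintro rfl
        exact hb hj
  refine h.min _ (glue_mem_candidates h.disj (h.mem.2.2.swap hi hj hij)) ⟨i, ?_, fun b hb => ?_⟩
  · rw [key_of_ne _ _ hiη, key_of_ne _ _ hiη, hgl, Equiv.swap_apply_left]
    exact hval
  · have hb1 : z (Equiv.swap i j b) = z b := by
      rw [Equiv.swap_apply_of_ne_of_ne (by omega) (by omega)]
    by_cases hbη : b = η
    · subst hbη
      rw [key_self, key_self, hgl, hgl, hb1]
      congr 2
      by_cases hbξ : b < ξ
      · rw [Equiv.swap_apply_of_ne_of_ne (by omega) (by omega)]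
      · rw [exceptional, if_neg hbξ, mem_insert, not_or] at hiEx hjEx
        rw [Equiv.swap_apply_of_ne_of_ne (Ne.symm hiEx.1) (Ne.symm hjEx.1)]
    · rw [key_of_ne _ _ hbη, key_of_ne _ _ hbη, hgl, hb1]

/-- With `m = 0` all values have equal quotas, so balance persists. Layering persists since the new
unit block lies above the old support, and inside an old unit block the zero entries, which form its
new unit block, lie above the nonzero ones. -/
theorem Invariant.snoc (hI : Invariant ξ η S col D) {z : Vec p}
    (h : IsStep c ξ η S O col t 0 z) : Invariant ξ η (S ∪ O) (snocCol col z) t := by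
  have hmem := mem_union_iff_snocCol hI.mem h.mem
  refine ⟨hmem, ⟨fun i hi => isNormalized_snocCol hI.mem hI.balanced h.mem hi, fun u hu => ?_⟩, ?_,
    h.shape⟩
  · rw [card_snocCol_eq hI.mem h.card h.disj h.mem hu]
    simp
  · intro i hi hiEx i' hi' hi'Ex j hj hi'j hne
    have hcol0 : ∀ b, b ∉ S → col b = 0 := fun b hb => by simpa [hI.mem] using hb
    have hcolumn : ∀ b (x : Fin l), snocCol col z b x.castSucc = col b x := fun b x => by
      simp [snocCol]
    have hlast : ∀ b, snocCol col z b (Fin.last l) = z b := fun b => by simp [snocCol]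
    induction j using Fin.lastCases with
    | last =>
      have h0 : col i' = 0 := by
        funext x
        rw [← hcolumn, hi'j]
        simp
      have hi'S : i' ∉ S := by simp [hI.mem, h0]
      have hi'O := (mem_union.1 hi').resolve_left hi'S
      have hiS : i ∈ S := by
        by_contra hc
        have hiO := (mem_union.1 hi).resolve_left hc
        apply hne
        rw [snocCol, snocCol, hcol0 i hc, h0, h.mem.1 i hiO, h.mem.1 i' hi'O]
      exact h.above i hiS hiEx i' hi'O hi'Ex
    | cast j =>
      rw [hcolumn] at hj
      have hc' : col i' = Pi.single j 1 := by
        funext x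
        rw [← hcolumn, hi'j]
        simp [Pi.single_apply]
      have hz' : z i' = 0 := by
        rw [← hlast, hi'j]
        simp [(Fin.castSucc_lt_last j).ne']
      have hiS : i ∈ S := by
        rw [hI.mem]
        intro h0
        simp [h0] at hj
      have hi'S : i' ∈ S := by
        rw [hI.mem, hc']
        exact (isNormalized_single j).ne_zero
      by_cases hcc : col i = col i'
      · have hzi : z i ≠ 0 := by
          intro h0
          apply hne
          rw [snocCol, snocCol, hcc, h0, hz']
        have hii : i ≠ i' := by
          rintro rfl
          exact hzi hz'
        by_contra hlt
        refine h.not_val_lt hiS hi'S hiEx hi'Ex hcc (by omega) ?_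
        rw [hz', ZMod.val_zero, ZMod.val_pos]
        exact hzi
      · exact hI.layered i hiS hiEx i' hi'S hi'Ex j hj hc' hcc

theorem invariant_zero (ξ η : ℕ) (col : ℕ → Fin 0 → ZMod p) (D : ℕ) :
    Invariant ξ η ∅ col D := by
  refine ⟨fun i => by simp [Subsingleton.elim (col i) 0], ⟨by simp, fun v hv => ?_⟩, ?_, ?_⟩
  · exact absurd (Subsingleton.elim v 0) hv.ne_zero
  · intro i hi
    simp at hi
  · left
    refine ⟨?_, 0, by simp⟩
    simp

end Extension

/-! ### The recursive words as linear combinations, and their order -/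

section Words

variable {p : ℕ} [Fact p.Prime] {F : Module.Basis ℕ (ZMod p) (Vec p)} {d : ℕ}

theorem exists_keyLT_of_mem_basisFamily (hF : F ∈ basisFamily p) :
    ∃ (c : ZMod p) (ξ η : ℕ), (η < ξ ∧ (c = 0 ∨ c = 1) ∨ ξ < η ∧ c = 1) ∧
      ∀ x y : Vec p, basisLT F x y ↔ KeyLT c ξ η x y := by
  rcases hF with hF | ⟨ξ, η, hne, rfl⟩
  · rw [Set.mem_singleton_iff] at hF
    subst hF
    -- The standard basis is treated as the case of zero coupling; any pair with `η < ξ` would do.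
    refine ⟨0, 1, 0, Or.inl ⟨one_pos, Or.inl rfl⟩, fun x y => ?_⟩
    have h : ∀ (x : Vec p) i, key 0 1 0 x i = (stdBasis p).repr x i := by
      intro x i
      unfold key
      split_ifs with hi
      · subst hi
        simp [stdBasis]
      · simp [stdBasis]
    simp only [basisLT, KeyLT, h]
  · refine ⟨1, ξ, η, ?_, fun x y => ?_⟩
    · rcases lt_or_gt_of_ne hne with h | h
      · exact Or.inr ⟨h, rfl⟩
      · exact Or.inl ⟨h, Or.inr rfl⟩
    have h : ∀ (x : Vec p) i, key 1 ξ η x i = (twistBasis p ξ η hne).repr x i := by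
      intro x i
      set e := LinearEquiv.transvection (f := Finsupp.lapply ξ)
        (v := Finsupp.single η (1 : ZMod p)) (by simp [hne.symm]) with he
      have h1 : (twistBasis p ξ η hne).repr x = e.symm x := by
        rw [twistBasis, Module.Basis.map_repr]
        simp [stdBasis, he]
      rw [h1]
      obtain ⟨y, rfl⟩ := e.surjective x
      rw [LinearEquiv.symm_apply_apply]
      have h2 : e y = y + y ξ • Finsupp.single η 1 := by
        rw [he, LinearEquiv.transvection.apply]
        simp
      rw [h2]
      unfold key
      split_ifs with hi
      · subst hi
        simp [hne]
      · simp [Ne.symm hi]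
    simp only [basisLT, KeyLT, h]

theorem word_eq_sum (F : Module.Basis ℕ (ZMod p) (Vec p)) (d : ℕ) {l b : ℕ} (hb : b < p ^ l) :
    word F d b = ∑ j : Fin l, ((b / p ^ (j : ℕ) % p : ℕ) : ZMod p) • word F d (p ^ (j : ℕ)) := by
  have hp := (Fact.out : p.Prime)
  rw [Fin.sum_univ_eq_sum_range (fun j => ((b / p ^ j % p : ℕ) : ZMod p) • word F d (p ^ j)) l]
  by_cases hpow : ∃ s, b = p ^ s
  · obtain ⟨s, rfl⟩ := hpow
    have hs : s < l := (Nat.pow_lt_pow_iff_right hp.one_lt).1 hb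
    rw [sum_eq_single_of_mem s (mem_range.2 hs)]
    · rw [Nat.div_self (pow_pos hp.pos s), Nat.mod_eq_of_lt hp.one_lt, Nat.cast_one, one_smul]
    · intro j _ hjs
      rcases lt_or_gt_of_ne hjs with hlt | hlt
      · rw [Nat.pow_div hlt.le hp.pos]
        have : p ∣ p ^ (s - j) := dvd_pow_self p (by omega)
        rw [Nat.mod_eq_zero_of_dvd this, Nat.cast_zero, zero_smul]
      · rw [Nat.div_eq_of_lt (Nat.pow_lt_pow_right hp.one_lt hlt), Nat.zero_mod, Nat.cast_zero,
          zero_smul]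
  · have hzero : ∀ i, b ≤ p ^ i → b / p ^ i = 0 := by
      intro i hi
      refine Nat.div_eq_of_lt (lt_of_le_of_ne hi fun hc => hpow ⟨i, hc⟩)
    rw [word, if_neg hpow]
    have h1 : ∀ i, (if _h : p ^ i < b then ((b / p ^ i % p : ℕ) : ZMod p) • word F d (p ^ i) else 0) =
        ((b / p ^ i % p : ℕ) : ZMod p) • word F d (p ^ i) := by
      intro i
      split_ifs with h
      · rfl
      · rw [hzero i (not_lt.1 h), Nat.zero_mod, Nat.cast_zero, zero_smul]
    rw [sum_congr rfl fun i _ => h1 i]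
    have h2 : ∀ n, (∀ i, n ≤ i → b ≤ p ^ i) → n ≤ b + l →
        ∑ i ∈ range n, ((b / p ^ i % p : ℕ) : ZMod p) • word F d (p ^ i) =
        ∑ i ∈ range (b + l), ((b / p ^ i % p : ℕ) : ZMod p) • word F d (p ^ i) := by
      intro n hn hle
      refine sum_subset (range_subset_range.2 hle) fun i _ hi => ?_
      rw [hzero i (hn i (not_lt.1 fun h => hi (mem_range.2 h))), Nat.zero_mod, Nat.cast_zero,
        zero_smul]
    -- The ranges `b` and `l` of digit positions are compared through the common range `b + l`, the
    -- extra digits being zero.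
    rw [h2 b _ (by omega), h2 l _ (by omega)]
    · intro i hi
      exact hb.le.trans (Nat.pow_le_pow_right hp.pos hi)
    · intro i hi
      exact hi.trans (Nat.lt_pow_self hp.one_lt).le

theorem exists_word_eq_sum (F : Module.Basis ℕ (ZMod p) (Vec p)) (d : ℕ) {l : ℕ}
    (v : Fin l → ZMod p) :
    ∃ b, b < p ^ l ∧ word F d b = ∑ j : Fin l, v j • word F d (p ^ (j : ℕ)) := by
  set f : Fin l → Fin p := fun j => ⟨(v j).val, ZMod.val_lt _⟩ with hf
  refine ⟨finFunctionFinEquiv f, (finFunctionFinEquiv f).2, ?_⟩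
  rw [word_eq_sum F d (finFunctionFinEquiv f).2]
  refine sum_congr rfl fun j _ => ?_
  have h : (finFunctionFinEquiv.symm (finFunctionFinEquiv f) j : ℕ) =
      (finFunctionFinEquiv f : ℕ) / p ^ (j : ℕ) % p := rfl
  rw [← h, Equiv.symm_apply_apply, hf]
  simp

/-- The columns of the matrix with rows `word F d (p ^ j)`, `j < l`. -/
def wordCol (F : Module.Basis ℕ (ZMod p) (Vec p)) (d l : ℕ) (i : ℕ) : Fin l → ZMod p :=
  fun j => word F d (p ^ (j : ℕ)) i

theorem sum_smul_word_apply (l : ℕ) (v : Fin l → ZMod p) (i : ℕ) :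
    (∑ j : Fin l, v j • word F d (p ^ (j : ℕ))) i = v ⬝ᵥ wordCol F d l i := by
  simp [Finsupp.finsetSum_apply, dotProduct, wordCol]

theorem wordCol_succ (l : ℕ) :
    wordCol F d (l + 1) = snocCol (wordCol F d l) (word F d (p ^ l)) := by
  funext i j
  induction j using Fin.lastCases with
  | last => simp [wordCol, snocCol]
  | cast j => simp [wordCol, snocCol]

theorem dist_eq_card {l : ℕ} {S : Finset ℕ} (hS : ∀ i, i ∈ S ↔ wordCol F d l i ≠ 0) (z : Vec p)
    (v : Fin l → ZMod p) :
    dist z (∑ j : Fin l, v j • word F d (p ^ (j : ℕ))) =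
      #{i ∈ S | v ⬝ᵥ wordCol F d l i ≠ z i} + #(z.support \ S) := by
  have hdisj : Disjoint (S.filter fun i => v ⬝ᵥ wordCol F d l i ≠ z i) (z.support \ S) :=
    disjoint_left.2 fun i hi hi' => (mem_sdiff.1 hi').2 (mem_filter.1 hi).1
  rw [dist, ← card_union_of_disjoint hdisj]
  congr 1
  ext i
  rw [Finsupp.mem_neLocus, sum_smul_word_apply, mem_union, mem_filter, mem_sdiff,
    Finsupp.mem_support_iff]
  by_cases hi : i ∈ S
  · simp only [hi, true_and, not_true, and_false, or_false]
    exact ne_comm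
  · have h0 : wordCol F d l i = 0 := by simpa [hS] using hi
    simp [hi, h0]

theorem setOf_dist_word_eq_admissible {l : ℕ} {S : Finset ℕ}
    (hS : ∀ i, i ∈ S ↔ wordCol F d l i ≠ 0) :
    {z | ∀ b, b < p ^ l → d ≤ dist z (word F d b)} = admissible S (wordCol F d l) d := by
  ext z
  constructor
  · intro h v
    obtain ⟨b, hb, hbv⟩ := exists_word_eq_sum F d v
    have := h b hb
    rwa [hbv, dist_eq_card hS] at this
  · intro h b hb
    have := h fun j => ((b / p ^ (j : ℕ) % p : ℕ) : ZMod p)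
    rwa [← dist_eq_card hS, ← word_eq_sum F d hb] at this

theorem word_pow (F : Module.Basis ℕ (ZMod p) (Vec p)) (d l : ℕ) :
    word F d (p ^ l) = basisMin F {z | ∀ b, b < p ^ l → d ≤ dist z (word F d b)} := by
  rw [word, if_pos ⟨l, rfl⟩]

theorem Invariant.exists_isStep_word {c : ZMod p} {ξ η : ℕ}
    (hcase : η < ξ ∧ (c = 0 ∨ c = 1) ∨ ξ < η ∧ c = 1)
    (hlt : ∀ x y : Vec p, basisLT F x y ↔ KeyLT c ξ η x y)
    {l D t m : ℕ} {S : Finset ℕ} (hI : Invariant ξ η S (wordCol F d l) D)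
    (hpd : p * d = p ^ l * D) (hD : D + m = p * t) (hm : m + 2 ≤ t) (hmp : m < p) :
    word F d (p ^ l) ∈ admissible S (wordCol F d l) d ∧
      ∃ O, IsStep c ξ η S O (wordCol F d l) t m (word F d (p ^ l)) := by
  have hne : (admissible S (wordCol F d l) d).Nonempty := by
    obtain ⟨O, hO, hdisj, -⟩ := exists_initial_notMem S t
    exact (candidates_nonempty hI.balanced hD (by omega) hdisj).mono
      (candidates_subset_admissible hI.balanced hpd hD (by omega) hO hdisj)
  have hw : word F d (p ^ l) = (basisLT_wf F).min _ hne := by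
    rw [word_pow, setOf_dist_word_eq_admissible hI.mem, basisMin, dif_pos hne]
  have hmem : word F d (p ^ l) ∈ admissible S (wordCol F d l) d := hw ▸ (basisLT_wf F).min_mem _ hne
  refine ⟨hmem, hI.exists_isStep hcase ?_ hpd hD hm hmp hmem fun x hx hc => ?_⟩
  · have := basisLT_wf F
    rwa [show basisLT F = fun x y : Vec p => KeyLT c ξ η x y from
      funext fun x => funext fun y => propext (hlt x y)] at this
  · rw [← hlt, hw] at hc
    exact (basisLT_wf F).not_lt_min _ hx hc

end Words

/-! ### Parameters, column distribution and the Solomon–Stiffler structure -/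

section Code

variable {p : ℕ} [Fact p.Prime] {F : Module.Basis ℕ (ZMod p) (Vec p)} {d : ℕ}

/-- Scaling the last nonzero coefficient to 1 turns a combination into the difference of a generator
and an earlier word, whose weight is their distance. -/
theorem le_card_support {l : ℕ}
    (hfar : ∀ j, j < l → ∀ b, b < p ^ j → d ≤ dist (word F d (p ^ j)) (word F d b))
    (v : Fin l → ZMod p) (hv : v ≠ 0) :
    d ≤ #(∑ j : Fin l, v j • word F d (p ^ (j : ℕ))).support := by
  induction l with
  | zero => exact absurd (Subsingleton.elim v 0) hv
  | succ l ih =>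
    rw [Fin.sum_univ_castSucc]
    simp only [Fin.val_castSucc, Fin.val_last]
    by_cases hl : v (Fin.last l) = 0
    · rw [hl, zero_smul, add_zero]
      refine ih (fun j hj => hfar j (by omega)) (fun j => v j.castSucc) fun hc => hv ?_
      funext j
      induction j using Fin.lastCases with
      | last => exact hl
      | cast j => exact congrFun hc j
    · obtain ⟨b, hb, hbv⟩ := exists_word_eq_sum F d
        fun j : Fin l => -(v (Fin.last l))⁻¹ * v j.castSucc
      have h := hfar l (Nat.lt_succ_self l) b hb
      have h2 : ∑ j : Fin l, v j.castSucc • word F d (p ^ (j : ℕ)) +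
          v (Fin.last l) • word F d (p ^ l) =
          v (Fin.last l) • (word F d (p ^ l) - word F d b) := by
        rw [hbv, smul_sub, smul_sum, add_comm, sub_eq_add_neg, ← sum_neg_distrib]
        congr 1
        refine sum_congr rfl fun j _ => ?_
        rw [smul_smul, ← neg_smul]
        congr 1
        field_simp
      rw [h2]
      refine h.trans (card_le_card fun i hi => ?_)
      rw [Finsupp.mem_neLocus] at hi
      rw [Finsupp.mem_support_iff, Finsupp.smul_apply, Finsupp.sub_apply, smul_eq_mul]
      exact mul_ne_zero hl (sub_ne_zero.2 hi)

/-- The distribution of the columns of the matrix formed by the first `k + 1` generating words. -/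
theorem exists_columns {k q r : ℕ} (hk : 1 ≤ k) (hr0 : 0 < r) (hrp : r < p)
    (hd : d = p ^ (k - 1) * (p * q + r)) (hqr : p + 1 ≤ q + r) (hF : F ∈ basisFamily p) :
    ∃ S : Finset ℕ, (∀ i, i ∈ S ↔ wordCol F d (k + 1) i ≠ 0) ∧
      (∀ i ∈ S, IsNormalized (wordCol F d (k + 1) i)) ∧
      (∀ u, IsNormalized u → #{i ∈ S | wordCol F d (k + 1) i = u} =
        if ∑ j, u j = 0 then q + r + 1 - p else q + 1) ∧
      #S = (p ^ k - 1) / (p - 1) * (p * q + r) + q + 1 ∧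
      (∀ v : Fin (k + 1) → ZMod p, v ≠ 0 →
        d ≤ #(∑ j : Fin (k + 1), v j • word F d (p ^ (j : ℕ))).support) ∧
      #(word F d 1).support = d := by
  have hp := (Fact.out : p.Prime)
  obtain ⟨c, ξ, η, hcase, hlt⟩ := exists_keyLT_of_mem_basisFamily hF
  have hpd : p * d = p ^ k * (p * q + r) := by
    rw [hd, ← mul_assoc, ← pow_succ', Nat.sub_add_cancel hk]
  have hpdl : ∀ l, l ≤ k → p * d = p ^ l * (p ^ (k - l) * (p * q + r)) := by
    intro l hl
    rw [hpd, ← mul_assoc, ← pow_add, Nat.add_sub_cancel' hl]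
  have hDl : ∀ l, l < k →
      p ^ (k - l) * (p * q + r) + 0 = p * (p ^ (k - (l + 1)) * (p * q + r)) := by
    intro l hl
    rw [add_zero, ← mul_assoc, ← pow_succ', show k - (l + 1) + 1 = k - l by omega]
  have htl : ∀ l, 0 + 2 ≤ p ^ (k - (l + 1)) * (p * q + r) := by
    intro l
    have h1 : 1 ≤ p ^ (k - (l + 1)) := Nat.one_le_pow _ _ hp.pos
    have h2 : q ≤ p * q := Nat.le_mul_of_pos_left _ hp.pos
    have h3 := Nat.mul_le_mul_right (p * q + r) h1
    have := hp.two_le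
    omega
  have hstep : ∀ l, l < k → ∀ S,
      Invariant ξ η S (wordCol F d l) (p ^ (k - l) * (p * q + r)) →
      word F d (p ^ l) ∈ admissible S (wordCol F d l) d ∧
      ∃ O, IsStep c ξ η S O (wordCol F d l) (p ^ (k - (l + 1)) * (p * q + r)) 0
        (word F d (p ^ l)) :=
    fun l hl S hI => hI.exists_isStep_word hcase hlt (hpdl l hl.le) (hDl l hl) (htl l) hp.pos
  have hinv : ∀ l, l ≤ k →
      ∃ S, Invariant ξ η S (wordCol F d l) (p ^ (k - l) * (p * q + r)) := by
    intro l
    induction l with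
    | zero => exact fun _ => ⟨∅, invariant_zero ξ η _ _⟩
    | succ l ih =>
      intro hl
      obtain ⟨S, hS⟩ := ih (by omega)
      obtain ⟨-, O, hO⟩ := hstep l (by omega) S hS
      exact ⟨S ∪ O, by rw [wordCol_succ]; exact hS.snoc hO⟩
  obtain ⟨S, hS⟩ := hinv k le_rfl
  rw [Nat.sub_self, pow_zero, one_mul] at hS
  -- This is where `q + r - p + 1 ≥ 2` is needed: it says that the scarce value still has quota at
  -- least two in the last step, where `t = q + 1` and `m = p - r`.
  have hm : p - r + 2 ≤ q + 1 := by omega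
  obtain ⟨hadm, O, hO⟩ := hS.exists_isStep_word hcase hlt hpd
    (show p * q + r + (p - r) = p * (q + 1) by rw [mul_add, mul_one]; omega) hm (by omega)
  refine ⟨S ∪ O, ?_, ?_, ?_, ?_, ?_, ?_⟩
  · rw [wordCol_succ]
    exact mem_union_iff_snocCol hS.mem hO.mem
  · rw [wordCol_succ]
    exact fun i hi => isNormalized_snocCol hS.mem hS.balanced hO.mem hi
  · intro u hu
    rw [wordCol_succ, card_snocCol_eq hS.mem hO.card hO.disj hO.mem hu,
      show q + 1 - (p - r) = q + r + 1 - p by omega]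
  · rw [card_union_of_disjoint hO.disj, hO.card, ← add_assoc]
    congr 2
    have h1 := hS.balanced.card_eq
    have hdvd : (p - 1) ∣ p ^ k - 1 := by simpa using Nat.sub_dvd_pow_sub_pow p 1 k
    obtain ⟨a, ha⟩ := hdvd
    have hp1 : 0 < p - 1 := by
      have := hp.two_le
      omega
    rw [ha, Nat.mul_div_cancel_left _ hp1]
    have h2 : (((p - 1 : ℕ)) : ℚ) = p - 1 := by rw [Nat.cast_sub hp.one_lt.le, Nat.cast_one]
    have h3 : ((p : ℚ) ^ k - 1) = ((p - 1 : ℕ) : ℚ) * a := by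
      rw [← Nat.cast_mul, ← ha, Nat.cast_sub (Nat.one_le_pow _ _ hp.pos), Nat.cast_pow, Nat.cast_one]
    rw [h3, ← h2] at h1
    have h4 : (p - 1) * #S = (p - 1) * (a * (p * q + r)) := by
      have : (p - 1) * #S = (p * q + r) * ((p - 1) * a) := by exact_mod_cast h1
      rw [this]
      ring
    exact Nat.eq_of_mul_eq_mul_left hp1 h4
  · refine le_card_support fun j hj => ?_
    rcases Nat.lt_succ_iff_lt_or_eq.1 hj with hjk | rfl
    · obtain ⟨T, hT⟩ := hinv j hjk.le
      have := (hstep j hjk T hT).1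
      rwa [← setOf_dist_word_eq_admissible hT.mem] at this
    · rwa [← setOf_dist_word_eq_admissible hS.mem] at hadm
  -- In the step from the zero code the word is the indicator of `O`, and `t = d` there.
  · obtain ⟨-, O, hO⟩ := hstep 0 hk ∅ (invariant_zero ξ η _ _)
    have h1 : (word F d 1).support = O := by
      ext i
      have h2 := hO.mem.1 i
      have h3 := hO.mem.2.1 i (by simp)
      rw [pow_zero] at h2 h3
      rw [Finsupp.mem_support_iff]
      constructor
      · intro h
        by_contra hc
        exact h (h3 hc)
      · intro h
        simp [h2 h]
    rw [h1, hO.card, hd, zero_add]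

theorem ceil_div {k q r : ℕ} (hk : 1 ≤ k) (hr0 : 0 < r) (hrp : r < p)
    (hd : d = p ^ (k - 1) * (p * q + r)) : ⌈(d : ℚ) / (p : ℚ) ^ k⌉₊ = q + 1 := by
  have hp := p_pos (p := p)
  have h1 : (d : ℚ) / (p : ℚ) ^ k = q + r / p := by
    have hpd : p * d = p ^ k * (p * q + r) := by
      rw [hd, ← mul_assoc, ← pow_succ', Nat.sub_add_cancel hk]
    have hpd' : (p : ℚ) * d = (p : ℚ) ^ k * (p * q + r) := by exact_mod_cast hpd
    rw [div_eq_iff (pow_pos hp k).ne']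
    field_simp
    linarith
  rw [h1, Nat.ceil_eq_iff (by omega)]
  have h2 : (0 : ℚ) < r / p := div_pos (by exact_mod_cast hr0) hp
  have h3 : (r : ℚ) / p < 1 := by
    rw [div_lt_one hp]
    exact_mod_cast hrp
  push_cast
  constructor <;> simp <;> linarith

theorem isPiDistributed_genMatrix {k q r : ℕ} (hk : 1 ≤ k) (hr0 : 0 < r) (hrp : r < p)
    (hd : d = p ^ (k - 1) * (p * q + r)) {S : Finset ℕ}
    (hS : ∀ i, i ∈ S ↔ wordCol F d (k + 1) i ≠ 0)
    (hnorm : ∀ i ∈ S, IsNormalized (wordCol F d (k + 1) i))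
    (hcard : ∀ u, IsNormalized u → #{i ∈ S | wordCol F d (k + 1) i = u} =
        if ∑ j, u j = 0 then q + r + 1 - p else q + 1) :
    IsPiDistributed k q r d (genMatrix F d k) := by
  intro v hv
  have hset : {i : ℕ | (genMatrix F d k).col i = v} =
      (({i ∈ S | wordCol F d (k + 1) i = v} : Finset ℕ) : Set ℕ) := by
    ext i
    have hcol : (genMatrix F d k).col i = wordCol F d (k + 1) i := rfl
    rw [Set.mem_ofPred_eq, hcol, mem_coe, mem_filter]
    refine ⟨fun h => ⟨(hS i).2 (h ▸ hv), h⟩, fun h => h.2⟩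
  rw [hset, Set.encard_coe_eq_coe_finsetCard]
  congr 1
  unfold piMult
  by_cases hvn : IsNormalized v
  · rw [hcard v hvn, if_pos (show v ∈ normalized p k from hvn), ceil_div hk hr0 hrp hd]
    by_cases hs : ∑ j, v j = 0
    · rw [if_pos hs, if_neg (by simp [hs])]
    · rw [if_neg hs, if_pos (Or.inr hs)]
  · rw [if_neg (show v ∉ normalized p k from hvn), card_eq_zero, filter_eq_empty_iff]
    rintro i hi rfl
    exact hvn (hnorm i hi)

theorem codeSupp_lexCode {l : ℕ} {S : Finset ℕ} (hS : ∀ i, i ∈ S ↔ wordCol F d l i ≠ 0) :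
    codeSupp (lexCode F d l) = S := by
  ext i
  rw [hS, codeSupp, mem_biUnion]
  constructor
  · rintro ⟨x, hx, hi⟩ h0
    rw [lexCode, mem_image] at hx
    obtain ⟨b, hb, rfl⟩ := hx
    rw [Finsupp.mem_support_iff, word_eq_sum F d (mem_range.1 hb), sum_smul_word_apply, h0] at hi
    simp at hi
  · intro h
    obtain ⟨j, hj⟩ := Function.ne_iff.1 h
    refine ⟨word F d (p ^ (j : ℕ)), ?_, by rwa [Finsupp.mem_support_iff]⟩
    rw [lexCode, mem_image]
    exact ⟨_, mem_range.2 (Nat.pow_lt_pow_right (Fact.out : p.Prime).one_lt j.2), rfl⟩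

/-- The generator matrix of the code of dimension `l` restricted to the coordinates in `S`. -/
def genRestrict (F : Module.Basis ℕ (ZMod p) (Vec p)) (d l : ℕ) (S : Finset ℕ) :
    Matrix (Fin l) S (ZMod p) :=
  Matrix.of fun j i => word F d (p ^ (j : ℕ)) i

theorem vecMul_genRestrict {l : ℕ} (S : Finset ℕ) (v : Fin l → ZMod p) (i : S) :
    (v ᵥ* genRestrict F d l S) i = (∑ j : Fin l, v j • word F d (p ^ (j : ℕ))) i := by
  rw [sum_smul_word_apply]
  rfl

theorem hammingNorm_vecMul_genRestrict {l : ℕ} {S : Finset ℕ}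
    (hS : ∀ i, i ∈ S ↔ wordCol F d l i ≠ 0) (v : Fin l → ZMod p) :
    hammingNorm (v ᵥ* genRestrict F d l S) =
      #(∑ j : Fin l, v j • word F d (p ^ (j : ℕ))).support := by
  rw [hammingNorm]
  refine card_bij (fun i _ => (i : ℕ)) ?_ (fun _ _ _ _ h => Subtype.ext h) ?_
  · intro i hi
    rw [mem_filter, vecMul_genRestrict] at hi
    rw [Finsupp.mem_support_iff]
    exact hi.2
  · intro i hi
    rw [Finsupp.mem_support_iff] at hi
    have hiS : i ∈ S := by
      rw [hS]
      intro h0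
      rw [sum_smul_word_apply, h0] at hi
      simp at hi
    refine ⟨⟨i, hiS⟩, ?_, rfl⟩
    rw [mem_filter, vecMul_genRestrict]
    exact ⟨mem_univ _, hi⟩

theorem range_vecMul_genRestrict {l : ℕ} (S : Finset ℕ) :
    ((genRestrict F d l S).vecMulLinear.range : Set (S → ZMod p)) =
      (fun (x : Vec p) (i : S) => x i) '' (lexCode F d l : Set (Vec p)) := by
  ext x
  constructor
  · rintro ⟨v, rfl⟩
    obtain ⟨b, hb, hbv⟩ := exists_word_eq_sum F d v
    refine ⟨word F d b, ?_, ?_⟩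
    · rw [lexCode, mem_coe, mem_image]
      exact ⟨b, mem_range.2 hb, rfl⟩
    · funext i
      rw [Matrix.vecMulLinear_apply, vecMul_genRestrict, hbv]
  · rintro ⟨y, hy, rfl⟩
    rw [lexCode, mem_coe, mem_image] at hy
    obtain ⟨b, hb, rfl⟩ := hy
    refine ⟨fun j => ((b / p ^ (j : ℕ) % p : ℕ) : ZMod p), ?_⟩
    funext i
    rw [Matrix.vecMulLinear_apply, vecMul_genRestrict, ← word_eq_sum F d (mem_range.1 hb)]

theorem vecMul_genRestrict_injective {l : ℕ} {S : Finset ℕ} (hd0 : 0 < d)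
    (hS : ∀ i, i ∈ S ↔ wordCol F d l i ≠ 0)
    (hfar : ∀ v : Fin l → ZMod p, v ≠ 0 →
      d ≤ #(∑ j : Fin l, v j • word F d (p ^ (j : ℕ))).support) :
    Function.Injective (genRestrict F d l S).vecMulLinear := by
  rw [← LinearMap.ker_eq_bot, LinearMap.ker_eq_bot']
  intro v hv
  by_contra hne
  have h1 := hfar v hne
  rw [← hammingNorm_vecMul_genRestrict hS, ← Matrix.vecMulLinear_apply, hv, hammingNorm_zero] at h1
  omega

theorem hasParams_range {l : ℕ} {S : Finset ℕ} (hd0 : 0 < d)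
    (hS : ∀ i, i ∈ S ↔ wordCol F d (l + 1) i ≠ 0)
    (hfar : ∀ v : Fin (l + 1) → ZMod p, v ≠ 0 →
      d ≤ #(∑ j : Fin (l + 1), v j • word F d (p ^ (j : ℕ))).support)
    (hone : #(word F d 1).support = d) :
    HasParams (genRestrict F d (l + 1) S).vecMulLinear.range #S (l + 1) d := by
  refine ⟨by simp, ?_, ?_, ?_⟩
  · rw [LinearMap.finrank_range_of_inj (vecMul_genRestrict_injective hd0 hS hfar)]
    simp
  · have hsum : ∑ j : Fin (l + 1), (Pi.single 0 1 : Fin (l + 1) → ZMod p) j • word F d (p ^ (j : ℕ)) =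
        word F d 1 := by
      rw [sum_eq_single_of_mem 0 (mem_univ _)]
      · simp
      · intro j _ hj
        simp [hj]
    have hnorm : hammingNorm ((Pi.single 0 1 : Fin (l + 1) → ZMod p) ᵥ* genRestrict F d (l + 1) S) = d := by
      rw [hammingNorm_vecMul_genRestrict hS, hsum, hone]
    refine ⟨_, ⟨Pi.single 0 1, rfl⟩, 0, Submodule.zero_mem _, ?_, ?_⟩
    · intro hc
      rw [Matrix.vecMulLinear_apply] at hc
      rw [hc, hammingNorm_zero] at hnorm
      omega
    · rw [hammingDist_zero_right, Matrix.vecMulLinear_apply, hnorm]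
  · rintro e ⟨x, ⟨v, rfl⟩, y, ⟨w, rfl⟩, hne, rfl⟩
    rw [hammingDist_eq_hammingNorm, ← map_neg, ← map_add, Matrix.vecMulLinear_apply,
      hammingNorm_vecMul_genRestrict hS]
    refine hfar _ fun hc => hne ?_
    rw [neg_add_eq_zero.1 hc]

theorem exists_isNormalized_span {l : ℕ} {P : Submodule (ZMod p) (Fin l → ZMod p)}
    (hP : Module.finrank (ZMod p) P = 1) :
    ∃ u, IsNormalized u ∧ P = Submodule.span (ZMod p) {u} := by
  obtain ⟨⟨w, hw⟩, hw0, hspan⟩ := finrank_eq_one_iff'.1 hP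
  have hw0' : w ≠ 0 := fun hc => hw0 (Subtype.ext hc)
  obtain ⟨a, ha, u, hu, rfl⟩ := exists_isNormalized_smul hw0'
  have hPw : P = Submodule.span (ZMod p) {a • u} := by
    apply le_antisymm
    · intro x hx
      obtain ⟨b, hb⟩ := hspan ⟨x, hx⟩
      rw [Submodule.mem_span_singleton]
      exact ⟨b, congrArg Subtype.val hb⟩
    · rwa [Submodule.span_singleton_le_iff_mem]
  refine ⟨u, hu, ?_⟩
  rw [hPw, Submodule.span_singleton_smul_eq (IsUnit.mk0 a ha)]

/-- The linear functional adding the coordinates. -/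
def coordSum (p l : ℕ) : (Fin l → ZMod p) →ₗ[ZMod p] ZMod p := ∑ j, LinearMap.proj j

theorem coordSum_apply {l : ℕ} (v : Fin l → ZMod p) : coordSum p l v = ∑ j, v j := by
  simp [coordSum]

theorem finrank_ker_coordSum (l : ℕ) :
    Module.finrank (ZMod p) (coordSum p (l + 1)).ker = l := by
  have hsurj : Function.Surjective (coordSum p (l + 1)) := fun a =>
    ⟨Pi.single 0 a, by rw [coordSum_apply]; simp⟩
  have h := LinearMap.finrank_range_add_finrank_ker (coordSum p (l + 1))
  rw [LinearMap.range_eq_top.2 hsurj, finrank_top, Module.finrank_self,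
    Module.finrank_fintype_fun_eq_card, Fintype.card_fin] at h
  omega

/-- Take `s = q + 1` and `p - r` copies of the hyperplane of coordinate sum zero; `0 < r` keeps
their number at most `p - 1`. Normalized columns meet each line in a single vector, so the points of
the line are counted by one multiplicity. -/
theorem isSolomonStiffler_range {k q r : ℕ} (hk : 1 ≤ k) (hr0 : 0 < r) (hrp : r < p)
    (hqr : p + 1 ≤ q + r) (hd0 : 0 < d) {S : Finset ℕ}
    (hS : ∀ i, i ∈ S ↔ wordCol F d (k + 1) i ≠ 0)
    (hnorm : ∀ i ∈ S, IsNormalized (wordCol F d (k + 1) i))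
    (hcard : ∀ u, IsNormalized u → #{i ∈ S | wordCol F d (k + 1) i = u} =
        if ∑ j, u j = 0 then q + r + 1 - p else q + 1)
    (hfar : ∀ v : Fin (k + 1) → ZMod p, v ≠ 0 →
      d ≤ #(∑ j : Fin (k + 1), v j • word F d (p ^ (j : ℕ))).support) :
    IsSolomonStiffler (genRestrict F d (k + 1) S).vecMulLinear.range (k + 1) := by
  have hcol : ∀ i : S, (genRestrict F d (k + 1) S).col i = wordCol F d (k + 1) i := fun _ => rfl
  refine ⟨genRestrict F d (k + 1) S, q + 1, p - r, fun _ => (coordSum p (k + 1)).ker, ?_, ?_, ?_,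
    ?_, ?_, ?_⟩
  · rw [← Matrix.vecMul_injective_iff]
    exact vecMul_genRestrict_injective hd0 hS hfar
  · exact (range_vecMulLinear _).symm
  · intro i
    rw [hcol]
    exact (hS i).1 i.2
  · intro i
    rw [finrank_ker_coordSum]
    omega
  · intro u
    dsimp only
    have h1 := Nat.card_le_card_of_injective
      (Subtype.val : {i : Fin (p - r) // Module.finrank (ZMod p) (coordSum p (k + 1)).ker = u} → _)
      Subtype.val_injective
    rw [Nat.card_eq_fintype_card (α := Fin (p - r)), Fintype.card_fin] at h1
    omega
  · intro P hP
    obtain ⟨u, hu, rfl⟩ := exists_isNormalized_span hP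
    have h1 : Nat.card {j : S // (genRestrict F d (k + 1) S).col j ∈ Submodule.span (ZMod p) {u}} =
        #{i ∈ S | wordCol F d (k + 1) i = u} := by
      rw [Nat.card_eq_fintype_card, Fintype.card_subtype]
      refine card_bij (fun i _ => (i : ℕ)) ?_ (fun _ _ _ _ h => Subtype.ext h) ?_
      · intro i hi
        rw [mem_filter, hcol, Submodule.mem_span_singleton] at hi
        obtain ⟨-, a, ha⟩ := hi
        rw [mem_filter]
        exact ⟨i.2, (hnorm i i.2).eq_of_smul hu ha.symm⟩
      · intro i hi
        obtain ⟨hiS, rfl⟩ := mem_filter.1 hi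
        exact ⟨⟨i, hiS⟩, mem_filter.2 ⟨mem_univ _, Submodule.mem_span_singleton_self _⟩, rfl⟩
    have h2 : Nat.card {i : Fin (p - r) // Submodule.span (ZMod p) {u} ≤ (coordSum p (k + 1)).ker} =
        if ∑ j, u j = 0 then p - r else 0 := by
      rw [Submodule.span_singleton_le_iff_mem, LinearMap.mem_ker, coordSum_apply]
      split_ifs with h
      · simp [h]
      · simp [h]
    rw [h1, h2, hcard u hu]
    split_ifs <;> omega

end Code

end LexCode

end

theorem theorem1p11 (p : ℕ) [Fact p.Prime] (k q r d : ℕ) (hk : 1 ≤ k)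
    (hr0 : 0 < r) (hrp : r < p) (hd : d = p ^ (k - 1) * (p * q + r))
    (hqr : (2 : ℤ) ≤ (q : ℤ) + r - p + 1)
    (F : Module.Basis ℕ (ZMod p) (LexCode.Vec p)) (hF : F ∈ LexCode.basisFamily p) :
    (∃ C : Submodule (ZMod p) (LexCode.codeSupp (LexCode.lexCode F d (k + 1)) → ZMod p),
      (C : Set (LexCode.codeSupp (LexCode.lexCode F d (k + 1)) → ZMod p)) =
        LexCode.res (LexCode.lexCode F d (k + 1)) ∧
      LexCode.HasParams C ((p ^ k - 1) / (p - 1) * (p * q + r) + q + 1) (k + 1) d ∧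
      LexCode.IsSolomonStiffler C (k + 1)) ∧
    LexCode.IsPiDistributed k q r d (LexCode.genMatrix F d k) := by
  have hqr' : p + 1 ≤ q + r := by omega
  have hd0 : 0 < d := by
    rw [hd]
    exact Nat.mul_pos (pow_pos (Fact.out : p.Prime).pos _) (by omega)
  obtain ⟨S, hS, hnorm, hcard, hn, hfar, hone⟩ := LexCode.exists_columns hk hr0 hrp hd hqr' hF
  obtain rfl := LexCode.codeSupp_lexCode hS
  refine ⟨⟨_, LexCode.range_vecMul_genRestrict _, ?_,
    LexCode.isSolomonStiffler_range hk hr0 hrp hqr' hd0 hS hnorm hcard hfar⟩,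
    LexCode.isPiDistributed_genMatrix hk hr0 hrp hd hS hnorm hcard⟩
  rw [← hn]
  exact LexCode.hasParams_range hd0 hS hfar hone
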